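/- All links are oriented. A twisted link diagram is a generic immersed closed oriented curve system in $\mathbb R^2$ whose double points are classical crossings (with over/under information) or virtual crossings, possibly with finitely many bars, a bar being a short segment that meets an arc of the diagram transversally in one point; a virtual link diagram is a twisted link diagram without bars. Two virtual link diagrams are equivalent if they are related, through virtual link diagrams, by finitely many isotopies of $\mathbb R^2$ and generalized Reidemeister moves: the classical moves R1, R2, R3, their analogues V1, V2, V3 with virtual crossings only, and V4 (an arc with only virtual crossings moves past a classical crossing). Two twisted link diagrams are equivalent if they are related by finitely many isotopies, generalized Reidemeister moves, and the moves T1 (a bar moves past a virtual crossing), T2 (two consecutive bars on an arc cancel), and T3 (a classical crossing with a bar on each of its four legs is replaced by the crossing without bars with the same sign in which over and under are exchanged, flanked by a virtual crossing on either side). A twisted link is an equivalence class of twisted link diagrams. A diagram is ordered if its components are numbered $1,\dots,m$; ordered equivalence has to respect the numbers, unordered equivalence ignores them. The double covering diagram $\widetilde D$ of a twisted link diagram $D$ is the following virtual link diagram. Put $D$ into the half plane $x>0$ so that the heights ($y$-coordinates) of all crossings, bars and local extrema are distinct. Let $s(D)$ be the reflection of $D$ in the $y$-axis with over and under switched at all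 classical crossings. In $s(D)\cup D$, for each bar of $D$ and its mirror image in $s(D)$, delete the two bars, cut the two strands there, and reconnect them crosswise by two arcs along the horizontal segment between the two bars; these arcs have only virtual crossings, with each other and with the strands that cross the segment. If $D$ is ordered with components $D_1,\dots,D_m$, then $\widetilde D$ is partitioned: each of its components carries the number $i$ of the component $D_i$ that it covers. Partitioned equivalence of such diagrams has to respect these labels, unpartitioned equivalence ignores them. **Theorem.** For each positive integer $n$ there is a pair of ordered twisted link diagrams $(D(n)^x, D(n)^y)$ such that 1. $D(n)^x$ and $D(n)^y$ are not equivalent, neither as ordered nor as unordered twisted links; 2. the double covering diagrams of $D(n)^x$ and $D(n)^y$ are equivalent as virtual links, both as partitioned and as unpartitioned ones; 3. for $n\ne n'$, each of the twisted links represented by $D(n)^x$ and $D(n)^y$ is different from each of those represented by $D(n')^x$ and $D(n')^y$, as ordered and as unordered twisted links. Consequently there are infinitely many pairs of distinct twisted links that have diagrams with equivalent double coverings, both for ordered twisted links (with partitioned equivalence of the double coverings) and for unordered ones (with unpartitioned equivalence). -/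

import Mathlib

namespace TwistedLinks

/-! Oriented link diagrams in the plane with classical crossings, virtual crossings and bars.

A diagram is put in general position with respect to the height function: local minima, local
maxima, crossings and bars lie on pairwise distinct heights. It is recorded from bottom to top as
the sequence of its elementary pieces, each together with the vertical strands on its left and on
its right. Every strand carries its direction and a colour (the number of its component, or the
label of a partition class). -/

/-- A strand that crosses a horizontal line: its colour and its direction. -/
structure Strand (κ : Type) where
  color : κ
  up : Bool

/-- The strand of the same colour with the opposite direction. -/
def Strand.flip {κ : Type} (a : Strand κ) : Strand κ := ⟨a.color, !a.up⟩

/-- The type of a crossing of two strands, read from bottom to top: the strand that enters at the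
bottom left passes over, it passes under, or the crossing is virtual. -/
inductive CrossingType where
  | over
  | under
  | virt

/-- The crossing type seen when the other strand is the one at the bottom left. -/
def CrossingType.inv : CrossingType → CrossingType
  | .over => .under
  | .under => .over
  | .virt => .virt

/-- The elementary pieces: local minimum, local maximum, crossing, bar. -/
inductive Piece (κ : Type) where
  | cup (a : Strand κ)
  | cap (a : Strand κ)
  | cross (x : CrossingType) (a b : Strand κ)
  | bar (a : Strand κ)

/-- The strands below a piece, from left to right. -/
def Piece.src {κ : Type} : Piece κ → List (Strand κ)
  | .cup _ => []
  | .cap a => [a, a.flip]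
  | .cross _ a b => [a, b]
  | .bar a => [a]

/-- The strands above a piece, from left to right. -/
def Piece.tgt {κ : Type} : Piece κ → List (Strand κ)
  | .cup a => [a, a.flip]
  | .cap _ => []
  | .cross _ a b => [b, a]
  | .bar a => [a]

/-- The piece is not a bar. -/
def Piece.NotBar {κ : Type} : Piece κ → Prop
  | .bar _ => False
  | _ => True

/-- A horizontal layer of a diagram: one elementary piece with vertical strands on both sides. -/
structure Layer (κ : Type) where
  left : List (Strand κ)
  piece : Piece κ
  right : List (Strand κ)

/-- The strands at the bottom of a layer. -/
def Layer.src {κ : Type} (L : Layer κ) : List (Strand κ) := L.left ++ L.piece.src ++ L.right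

/-- The strands at the top of a layer. -/
def Layer.tgt {κ : Type} (L : Layer κ) : List (Strand κ) := L.left ++ L.piece.tgt ++ L.right

/-- Further vertical strands `l` on the left and `r` on the right of a layer. -/
def Layer.widen {κ : Type} (l r : List (Strand κ)) (L : Layer κ) : Layer κ :=
  ⟨l ++ L.left, L.piece, L.right ++ r⟩

/-- The layers of the list fit on top of each other, from the strands `s` at the bottom to the
strands `t` at the top. -/
def IsPath {κ : Type} : List (Strand κ) → List (Layer κ) → List (Strand κ) → Prop
  | s, [], t => s = t
  | s, L :: w, t => L.src = s ∧ IsPath L.tgt w t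

/-- A twisted link diagram (oriented, with coloured strands). -/
structure Diagram (κ : Type) where
  layers : List (Layer κ)
  closed : IsPath [] layers []

/-- A virtual link diagram: a diagram without bars. -/
structure VirtualDiagram (κ : Type) extends Diagram κ where
  noBar : ∀ L ∈ layers, L.piece.NotBar

/-! ### Isotopies of the plane and Reidemeister moves -/

/-- Isotopies of the plane, generated by the passages through the non-generic height functions. -/
inductive Isotopy {κ : Type} : List (Layer κ) → List (Layer κ) → Prop
  /-- two pieces side by side exchange their heights -/
  | exchange (g h : Piece κ) (m : List (Strand κ)) :
      Isotopy [⟨[], g, m ++ h.src⟩, ⟨g.tgt ++ m, h, []⟩]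
        [⟨g.src ++ m, h, []⟩, ⟨[], g, m ++ h.tgt⟩]
  /-- a local minimum and a local maximum cancel -/
  | zigzag_right (a : Strand κ) :
      Isotopy [⟨[a], .cup a.flip, []⟩, ⟨[], .cap a, [a]⟩] []
  | zigzag_left (a : Strand κ) :
      Isotopy [⟨[], .cup a, [a]⟩, ⟨[a], .cap a.flip, []⟩] []
  /-- a crossing moves over a local maximum of one of its two strands -/
  | cross_cap (x : CrossingType) (a b : Strand κ) :
      Isotopy [⟨[], .cross x a b, [a.flip]⟩, ⟨[b], .cap a, []⟩]
        [⟨[a], .cross x.inv b a.flip, []⟩, ⟨[], .cap a, [b]⟩]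
  /-- a crossing moves through a local minimum of one of its two strands -/
  | cross_cup (x : CrossingType) (a b : Strand κ) :
      Isotopy [⟨[b], .cup a, []⟩, ⟨[], .cross x b a, [a.flip]⟩]
        [⟨[], .cup a, [b]⟩, ⟨[a], .cross x.inv a.flip b, []⟩]
  /-- a bar moves over a local maximum -/
  | bar_cap (a : Strand κ) :
      Isotopy [⟨[], .bar a, [a.flip]⟩, ⟨[], .cap a, []⟩]
        [⟨[a], .bar a.flip, []⟩, ⟨[], .cap a, []⟩]
  /-- a bar moves through a local minimum -/
  | bar_cup (a : Strand κ) :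
      Isotopy [⟨[], .cup a, []⟩, ⟨[], .bar a, [a.flip]⟩]
        [⟨[], .cup a, []⟩, ⟨[a], .bar a.flip, []⟩]

/-- Three strands `a`, `b`, `c`, from left to right at the bottom, meet pairwise in crossings of
types `x` (for `a`, `b`), `y` (for `a`, `c`) and `z` (for `b`, `c`). The triangle move R3 applies
when all three are classical and one strand lies above, one between, one below; V3 applies when all
three are virtual; V4 applies when exactly two are virtual (so that one strand has only virtual
crossings with the other two). -/
def TriangleMove : CrossingType → CrossingType → CrossingType → Prop
  | .over, .under, .over => False
  | .under, .over, .under => False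
  | .over, .over, .over => True
  | .over, .over, .under => True
  | .over, .under, .under => True
  | .under, .over, .over => True
  | .under, .under, .over => True
  | .under, .under, .under => True
  | .virt, .virt, _ => True
  | .virt, _, .virt => True
  | _, .virt, .virt => True
  | _, _, _ => False

/-- The generalized Reidemeister moves, with all orientations. For classical crossings the
constructors are R1 (both forms), R2, R3; for virtual ones V1, V2, V3; the mixed case of the last
one is V4. -/
inductive Generalized {κ : Type} : List (Layer κ) → List (Layer κ) → Prop
  | one_right (x : CrossingType) (a : Strand κ) :
      Generalized [⟨[a], .cup a, []⟩, ⟨[], .cross x a a, [a.flip]⟩, ⟨[a], .cap a, []⟩] []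
  | one_left (x : CrossingType) (a : Strand κ) :
      Generalized
        [⟨[], .cup a.flip, [a]⟩, ⟨[a.flip], .cross x a a, []⟩, ⟨[], .cap a.flip, [a]⟩] []
  | two (x : CrossingType) (a b : Strand κ) :
      Generalized [⟨[], .cross x a b, []⟩, ⟨[], .cross x.inv b a, []⟩] []
  | three (x y z : CrossingType) (h : TriangleMove x y z) (a b c : Strand κ) :
      Generalized
        [⟨[], .cross x a b, [c]⟩, ⟨[b], .cross y a c, []⟩, ⟨[], .cross z b c, [a]⟩]
        [⟨[a], .cross z b c, []⟩, ⟨[], .cross y a c, [b]⟩, ⟨[c], .cross x a b, []⟩]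

/-- The moves T1 (a bar passes a virtual crossing, on either strand), T2 (two consecutive bars
cancel) and T3 (a classical crossing with a bar on each of its four legs is seen from behind). -/
inductive Twisting {κ : Type} : List (Layer κ) → List (Layer κ) → Prop
  | one_left (a b : Strand κ) :
      Twisting [⟨[], .bar a, [b]⟩, ⟨[], .cross .virt a b, []⟩]
        [⟨[], .cross .virt a b, []⟩, ⟨[b], .bar a, []⟩]
  | one_right (a b : Strand κ) :
      Twisting [⟨[a], .bar b, []⟩, ⟨[], .cross .virt a b, []⟩]
        [⟨[], .cross .virt a b, []⟩, ⟨[], .bar b, [a]⟩]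
  | two (a : Strand κ) :
      Twisting [⟨[], .bar a, []⟩, ⟨[], .bar a, []⟩] []
  | three (x : CrossingType) (hx : x ≠ .virt) (a b : Strand κ) :
      Twisting
        [⟨[], .bar a, [b]⟩, ⟨[a], .bar b, []⟩, ⟨[], .cross x a b, []⟩,
          ⟨[], .bar b, [a]⟩, ⟨[b], .bar a, []⟩]
        [⟨[], .cross .virt a b, []⟩, ⟨[], .cross x b a, []⟩, ⟨[], .cross .virt a b, []⟩]

/-- `E` arises from `D` when one part of `D` is replaced by a related one. -/
def Replace {κ : Type} (R : List (Layer κ) → List (Layer κ) → Prop) (D E : Diagram κ) : Prop :=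
  ∃ (p q u v : List (Layer κ)) (l r : List (Strand κ)), R u v ∧
    D.layers = p ++ u.map (Layer.widen l r) ++ q ∧ E.layers = p ++ v.map (Layer.widen l r) ++ q

/-- An isotopy or a generalized Reidemeister move. -/
def VirtualMove {κ : Type} (D E : Diagram κ) : Prop :=
  Replace Isotopy D E ∨ Replace Generalized D E

/-- An isotopy or an extended Reidemeister move. -/
def TwistedMove {κ : Type} (D E : Diagram κ) : Prop :=
  Replace Isotopy D E ∨ Replace Generalized D E ∨ Replace Twisting D E

/-- Equivalence of virtual link diagrams, through virtual link diagrams, respecting the colours. -/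
def VirtualEquiv {κ : Type} (D E : VirtualDiagram κ) : Prop :=
  Relation.EqvGen (fun D E : VirtualDiagram κ => VirtualMove D.toDiagram E.toDiagram) D E

/-! ### Components and orderings -/

/-- The strands at height `k`: between the layers with indices `k - 1` and `k`. -/
def Diagram.level {κ : Type} (D : Diagram κ) : ℕ → List (Strand κ)
  | 0 => []
  | k + 1 => ((D.layers[k]?).map Layer.tgt).getD []

/-- Two points (height, position from the left) are joined by an arc inside one layer. -/
inductive Diagram.Joined {κ : Type} (D : Diagram κ) : ℕ × ℕ → ℕ × ℕ → Prop
  | left (k i : ℕ) (L : Layer κ) (hL : D.layers[k]? = some L) (hi : i < L.left.length) :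
      D.Joined (k, i) (k + 1, i)
  | right (k i : ℕ) (L : Layer κ) (hL : D.layers[k]? = some L) (hi : i < L.right.length) :
      D.Joined (k, L.left.length + L.piece.src.length + i)
        (k + 1, L.left.length + L.piece.tgt.length + i)
  | cup (k : ℕ) (l r : List (Strand κ)) (a : Strand κ)
      (hL : D.layers[k]? = some ⟨l, .cup a, r⟩) :
      D.Joined (k + 1, l.length) (k + 1, l.length + 1)
  | cap (k : ℕ) (l r : List (Strand κ)) (a : Strand κ)
      (hL : D.layers[k]? = some ⟨l, .cap a, r⟩) :
      D.Joined (k, l.length) (k, l.length + 1)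
  | cross_left (k : ℕ) (l r : List (Strand κ)) (x : CrossingType) (a b : Strand κ)
      (hL : D.layers[k]? = some ⟨l, .cross x a b, r⟩) :
      D.Joined (k, l.length) (k + 1, l.length + 1)
  | cross_right (k : ℕ) (l r : List (Strand κ)) (x : CrossingType) (a b : Strand κ)
      (hL : D.layers[k]? = some ⟨l, .cross x a b, r⟩) :
      D.Joined (k, l.length + 1) (k + 1, l.length)
  | bar (k : ℕ) (l r : List (Strand κ)) (a : Strand κ)
      (hL : D.layers[k]? = some ⟨l, .bar a, r⟩) :
      D.Joined (k, l.length) (k + 1, l.length)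

/-- An ordered twisted link diagram: the components are numbered `1, …, numComponents`, and the
colour of a strand is the number of its component. -/
structure OrderedDiagram extends Diagram ℕ where
  numComponents : ℕ
  numbers : ∀ c : ℕ, (∃ k, ∃ a ∈ toDiagram.level k, a.color = c) ↔ 1 ≤ c ∧ c ≤ numComponents
  one_component : ∀ (k k' i i' : ℕ) (a a' : Strand ℕ), (toDiagram.level k)[i]? = some a →
    (toDiagram.level k')[i']? = some a' → a.color = a'.color →
      Relation.EqvGen toDiagram.Joined (k, i) (k', i')

/-- Equivalence of ordered twisted link diagrams. -/
def OrderedEquiv (D E : OrderedDiagram) : Prop :=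
  Relation.EqvGen (fun D E : OrderedDiagram => TwistedMove D.toDiagram E.toDiagram) D E

/-- The ordered twisted links. -/
def OrderedTwistedLink : Type :=
  Quotient (Relation.EqvGen.setoid
    (fun D E : OrderedDiagram => TwistedMove D.toDiagram E.toDiagram))

/-- The ordered twisted link represented by a diagram. -/
def OrderedDiagram.link (D : OrderedDiagram) : OrderedTwistedLink := Quotient.mk _ D

/-! ### Forgetting the colours -/

/-- Forget the colour of a strand. -/
def Strand.forget {κ : Type} (a : Strand κ) : Strand Unit := ⟨(), a.up⟩

/-- Forget the colours in a piece. -/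
def Piece.forget {κ : Type} : Piece κ → Piece Unit
  | .cup a => .cup a.forget
  | .cap a => .cap a.forget
  | .cross x a b => .cross x a.forget b.forget
  | .bar a => .bar a.forget

/-- Forget the colours in a layer. -/
def Layer.forget {κ : Type} (L : Layer κ) : Layer Unit :=
  ⟨L.left.map Strand.forget, L.piece.forget, L.right.map Strand.forget⟩

theorem Layer.forget_src {κ : Type} (L : Layer κ) :
    L.forget.src = L.src.map Strand.forget := by
  obtain ⟨l, p, r⟩ := L
  cases p <;> simp [Layer.forget, Layer.src, Piece.forget, Piece.src, Strand.forget, Strand.flip]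

theorem Layer.forget_tgt {κ : Type} (L : Layer κ) :
    L.forget.tgt = L.tgt.map Strand.forget := by
  obtain ⟨l, p, r⟩ := L
  cases p <;> simp [Layer.forget, Layer.tgt, Piece.forget, Piece.tgt, Strand.forget, Strand.flip]

theorem IsPath.forget {κ : Type} {w : List (Layer κ)} : ∀ {s t : List (Strand κ)}, IsPath s w t →
    IsPath (s.map Strand.forget) (w.map Layer.forget) (t.map Strand.forget) := by
  induction w with
  | nil => rintro s t rfl; rfl
  | cons L w ih =>
    rintro s t ⟨rfl, h⟩
    refine ⟨L.forget_src, ?_⟩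
    rw [L.forget_tgt]
    exact ih h

/-- The unordered diagram underlying a diagram. -/
def Diagram.forget {κ : Type} (D : Diagram κ) : Diagram Unit :=
  ⟨D.layers.map Layer.forget, D.closed.forget⟩

/-- The unpartitioned virtual diagram underlying a virtual diagram. -/
def VirtualDiagram.forget {κ : Type} (D : VirtualDiagram κ) : VirtualDiagram Unit where
  toDiagram := D.toDiagram.forget
  noBar := by
    intro L hL
    obtain ⟨L', h', rfl⟩ := List.mem_map.1 hL
    have := D.noBar L' h'
    obtain ⟨l, p, r⟩ := L'
    cases p <;> exact this

/-- Equivalence of unordered twisted link diagrams. -/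
def UnorderedEquiv (D E : Diagram Unit) : Prop := Relation.EqvGen TwistedMove D E

/-- The unordered twisted links. -/
def UnorderedTwistedLink : Type :=
  Quotient (Relation.EqvGen.setoid (TwistedMove (κ := Unit)))

/-- The unordered twisted link represented by a diagram. -/
def Diagram.unorderedLink (D : Diagram Unit) : UnorderedTwistedLink := Quotient.mk _ D

/-! ### Double coverings

To the left of the diagram `D` one puts `s(D)`: the reflection of `D` in a vertical line with over
and under switched at all classical crossings. Then at each bar of `D` and its mirror image in
`s(D)`, the two strands are cut and joined crosswise by two arcs, which run along the horizontal
segment between the two bars and have only virtual crossings, with each other and with the strands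
that cross the segment. -/

/-- The strand `a` moves to the right, with virtual crossings, past the strands of the list. -/
def slideRight {κ : Type} (a : Strand κ) :
    List (Strand κ) → List (Strand κ) → List (Strand κ) → List (Layer κ)
  | _, [], _ => []
  | l, b :: m, r => ⟨l, .cross .virt a b, m ++ r⟩ :: slideRight a (l ++ [b]) m r

/-- The strand `a` moves to the left, with virtual crossings, past the strands of the list. -/
def slideLeft {κ : Type} (a : Strand κ) :
    List (Strand κ) → List (Strand κ) → List (Strand κ) → List (Layer κ)
  | _, [], _ => []
  | l, b :: m, r => slideLeft a (l ++ [b]) m r ++ [⟨l, .cross .virt b a, m ++ r⟩]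

/-- Reflection of a piece in a vertical line, with over and under switched. Both the reflection and
the switch exchange `over` and `under`, so that the crossing type is unchanged. -/
def Piece.mirror {κ : Type} : Piece κ → Piece κ
  | .cup a => .cup a.flip
  | .cap a => .cap a.flip
  | .cross x a b => .cross x b a
  | .bar a => .bar a

/-- The part of the double covering diagram over a layer. -/
def Layer.double {κ : Type} : Layer κ → List (Layer κ)
  | ⟨l, .bar a, r⟩ =>
      slideRight a r.reverse (l.reverse ++ l ++ [a]) r ++
        slideLeft a r.reverse (l.reverse ++ l) (a :: r)
  | ⟨l, p, r⟩ =>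
      [⟨r.reverse, p.mirror, l.reverse ++ l ++ p.src ++ r⟩,
        ⟨r.reverse ++ p.tgt.reverse ++ l.reverse ++ l, p, r⟩]

theorem IsPath.append {κ : Type} {w w' : List (Layer κ)} : ∀ {s t t' : List (Strand κ)},
    IsPath s w t → IsPath t w' t' → IsPath s (w ++ w') t' := by
  induction w with
  | nil => rintro s t t' rfl h; exact h
  | cons L w ih =>
    rintro s t t' ⟨h, h1⟩ h2
    exact ⟨h, ih h1 h2⟩

theorem isPath_slideRight {κ : Type} (a : Strand κ) (m : List (Strand κ)) :
    ∀ l r, IsPath (l ++ a :: (m ++ r)) (slideRight a l m r) (l ++ m ++ a :: r) := by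
  induction m with
  | nil => intro l r; simp [slideRight, IsPath]
  | cons b m ih =>
    intro l r
    refine ⟨by simp [Layer.src, Piece.src], ?_⟩
    have := ih (l ++ [b]) r
    simpa [Layer.tgt, Piece.tgt] using this

theorem isPath_slideLeft {κ : Type} (a : Strand κ) (m : List (Strand κ)) :
    ∀ l r, IsPath (l ++ m ++ a :: r) (slideLeft a l m r) (l ++ a :: (m ++ r)) := by
  induction m with
  | nil => intro l r; simp [slideLeft, IsPath]
  | cons b m ih =>
    intro l r
    have := ih (l ++ [b]) r
    refine IsPath.append (t := l ++ b :: a :: (m ++ r)) (by simpa using this) ?_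
    simp [IsPath, Layer.src, Layer.tgt, Piece.src, Piece.tgt]

theorem isPath_double {κ : Type} (L : Layer κ) :
    IsPath (L.src.reverse ++ L.src) L.double (L.tgt.reverse ++ L.tgt) := by
  obtain ⟨l, p, r⟩ := L
  cases p with
  | bar a =>
    refine IsPath.append (t := r.reverse ++ (l.reverse ++ l ++ [a]) ++ a :: r) ?_ ?_
    · have := isPath_slideRight a (l.reverse ++ l ++ [a]) r.reverse r
      simpa [Layer.src, Piece.src] using this
    · have := isPath_slideLeft a (l.reverse ++ l) r.reverse (a :: r)
      simpa [Layer.tgt, Piece.tgt] using this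
  | cup a | cap a | cross x a b =>
    simp [Layer.double, IsPath, Layer.src, Layer.tgt, Piece.src, Piece.tgt, Piece.mirror,
      Strand.flip]

theorem isPath_flatMap_double {κ : Type} {w : List (Layer κ)} : ∀ {s t : List (Strand κ)},
    IsPath s w t → IsPath (s.reverse ++ s) (w.flatMap Layer.double) (t.reverse ++ t) := by
  induction w with
  | nil => rintro s t rfl; rfl
  | cons L w ih =>
    rintro s t ⟨rfl, h⟩
    exact (isPath_double L).append (ih h)

theorem notBar_slideRight {κ : Type} (a : Strand κ) (m : List (Strand κ)) :
    ∀ l r, ∀ L ∈ slideRight a l m r, L.piece.NotBar := by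
  induction m with
  | nil => intro l r L hL; simp [slideRight] at hL
  | cons b m ih =>
    intro l r L hL
    rcases List.mem_cons.1 hL with rfl | hL
    · trivial
    · exact ih _ _ L hL

theorem notBar_slideLeft {κ : Type} (a : Strand κ) (m : List (Strand κ)) :
    ∀ l r, ∀ L ∈ slideLeft a l m r, L.piece.NotBar := by
  induction m with
  | nil => intro l r L hL; simp [slideLeft] at hL
  | cons b m ih =>
    intro l r L hL
    rcases List.mem_append.1 hL with hL | hL
    · exact ih _ _ L hL
    · obtain rfl := List.mem_singleton.1 hL
      trivial

theorem notBar_double {κ : Type} (L : Layer κ) : ∀ L' ∈ L.double, L'.piece.NotBar := by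
  obtain ⟨l, p, r⟩ := L
  intro L' hL'
  cases p with
  | bar a =>
    rcases List.mem_append.1 hL' with h | h
    · exact notBar_slideRight _ _ _ _ L' h
    · exact notBar_slideLeft _ _ _ _ L' h
  | cup a | cap a | cross x a b =>
    simp only [Layer.double, List.mem_cons, List.not_mem_nil, or_false] at hL'
    rcases hL' with rfl | rfl <;> trivial

/-- The double covering diagram. It has no bars, and it inherits the colours of the diagram: the
double covering of an ordered diagram is partitioned by the numbers of the components. -/
def Diagram.double {κ : Type} (D : Diagram κ) : VirtualDiagram κ where
  layers := D.layers.flatMap Layer.double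
  closed := isPath_flatMap_double D.closed
  noBar := by
    intro L hL
    obtain ⟨L', _, h⟩ := List.mem_flatMap.1 hL
    exact notBar_double L' L h

end TwistedLinks

namespace TwistedLinks

/-! ### Forgetting colours respects the moves -/

/-! Both members of a pair are double covers of one twisted diagram: a curve with one crossing and a
bar on each of its two loops, together with a circle that meets the second loop. Such a cover
prescribes for each closed curve a shift in `ℤ/2`, the interchange of its two parallel copies. The
two members have shifts `(0,1)` and `(1,0)` on the two loops, and the circle has shift `1` in both.

Their double covering diagrams add the sheet as a second coordinate in `ℤ/2`; it changes along each
loop because of the bars, but not along the circle. The automorphism `(sheet, copy) ↦ (sheet, sheet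
+ copy)` carries one covering to the other: interchange the two copies of every strand over the
mirror image. `virtualEquiv_double_coverDiagram` realises this by an explicit sequence of moves that
is checked by computation.

The twisted links themselves are separated by a state sum. A state gives each point of the diagram a
parity, which changes at classical crossings, and a sheet, which changes at bars. A crossing
contributes `t` or `t⁻¹`, according to its sign, when its two strands differ both in sheet and in
incoming parity. The sum over all states is an invariant (`UnorderedEquiv.stateSum_eq`). It equals
`12t² + 4t⁴` for one member and `12 + 4t²` for the other, and the values at `t = 2` in `ZMod 5`
already differ.

Each further disjoint circle multiplies the sum by `4`, a unit modulo `5`, so the members of a pair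
stay distinct; at `t = 1` the power of `4` separates different `n`. Equivalences are proved with
colours and inequivalences without them, and forgetting colours gives the remaining cases. -/

theorem Strand.forget_flip {κ : Type} (a : Strand κ) : a.flip.forget = a.forget.flip := rfl

theorem Piece.forget_src {κ : Type} (p : Piece κ) :
    p.forget.src = p.src.map Strand.forget := by
  cases p <;> simp [Piece.forget, Piece.src, Strand.forget_flip]

theorem Piece.forget_tgt {κ : Type} (p : Piece κ) :
    p.forget.tgt = p.tgt.map Strand.forget := by
  cases p <;> simp [Piece.forget, Piece.tgt, Strand.forget_flip]

theorem Isotopy.forget {κ : Type} {u v : List (Layer κ)} (h : Isotopy u v) :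
    Isotopy (u.map Layer.forget) (v.map Layer.forget) := by
  cases h with
  | exchange g h m =>
    simpa [Layer.forget, Piece.forget_src, Piece.forget_tgt] using
      Isotopy.exchange g.forget h.forget (m.map Strand.forget)
  | zigzag_right a => exact .zigzag_right a.forget
  | zigzag_left a => exact .zigzag_left a.forget
  | cross_cap x a b => exact .cross_cap x a.forget b.forget
  | cross_cup x a b => exact .cross_cup x a.forget b.forget
  | bar_cap a => exact .bar_cap a.forget
  | bar_cup a => exact .bar_cup a.forget

theorem Generalized.forget {κ : Type} {u v : List (Layer κ)} (h : Generalized u v) :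
    Generalized (u.map Layer.forget) (v.map Layer.forget) := by
  cases h with
  | one_right x a => exact .one_right x a.forget
  | one_left x a => exact .one_left x a.forget
  | two x a b => exact .two x a.forget b.forget
  | three x y z h a b c => exact .three x y z h a.forget b.forget c.forget

theorem Twisting.forget {κ : Type} {u v : List (Layer κ)} (h : Twisting u v) :
    Twisting (u.map Layer.forget) (v.map Layer.forget) := by
  cases h with
  | one_left a b => exact .one_left a.forget b.forget
  | one_right a b => exact .one_right a.forget b.forget
  | two a => exact .two a.forget
  | three x hx a b => exact .three x hx a.forget b.forget

theorem Layer.forget_widen {κ : Type} (l r : List (Strand κ)) (L : Layer κ) :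
    (L.widen l r).forget = L.forget.widen (l.map Strand.forget) (r.map Strand.forget) := by
  simp [Layer.forget, Layer.widen]

theorem Replace.forget {κ : Type} {R : List (Layer κ) → List (Layer κ) → Prop}
    {S : List (Layer Unit) → List (Layer Unit) → Prop}
    (hRS : ∀ u v, R u v → S (u.map Layer.forget) (v.map Layer.forget)) {D E : Diagram κ}
    (h : Replace R D E) : Replace S D.forget E.forget := by
  obtain ⟨p, q, u, v, l, r, hR, hD, hE⟩ := h
  refine ⟨p.map Layer.forget, q.map Layer.forget, _, _, l.map Strand.forget,
    r.map Strand.forget, hRS u v hR, ?_, ?_⟩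
  · simp [Diagram.forget, hD, Layer.forget_widen]
  · simp [Diagram.forget, hE, Layer.forget_widen]

theorem TwistedMove.forget {κ : Type} {D E : Diagram κ} (h : TwistedMove D E) :
    TwistedMove D.forget E.forget :=
  h.imp (Replace.forget fun _ _ => Isotopy.forget)
    (Or.imp (Replace.forget fun _ _ => Generalized.forget)
      (Replace.forget fun _ _ => Twisting.forget))

theorem VirtualMove.forget {κ : Type} {D E : Diagram κ} (h : VirtualMove D E) :
    VirtualMove D.forget E.forget :=
  h.imp (Replace.forget fun _ _ => Isotopy.forget)
    (Replace.forget fun _ _ => Generalized.forget)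

theorem eqvGen_map {α β : Type*} {r : α → α → Prop} {s : β → β → Prop} (f : α → β)
    (hf : ∀ a b, r a b → s (f a) (f b)) {a b : α} (h : Relation.EqvGen r a b) :
    Relation.EqvGen s (f a) (f b) := by
  induction h with
  | rel a b h => exact .rel _ _ (hf a b h)
  | refl a => exact .refl _
  | symm a b _ ih => exact .symm _ _ ih
  | trans a b c _ _ ih ih' => exact .trans _ _ _ ih ih'

theorem OrderedEquiv.forget {D E : OrderedDiagram} (h : OrderedEquiv D E) :
    UnorderedEquiv D.forget E.forget :=
  eqvGen_map (fun D : OrderedDiagram => D.toDiagram.forget) (fun _ _ => TwistedMove.forget) h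

theorem VirtualEquiv.forget {κ : Type} {D E : VirtualDiagram κ} (h : VirtualEquiv D E) :
    VirtualEquiv D.forget E.forget :=
  eqvGen_map VirtualDiagram.forget (fun _ _ => VirtualMove.forget) h

theorem slideRight_forget {κ : Type} (a : Strand κ) (m : List (Strand κ)) : ∀ l r,
    (slideRight a l m r).map Layer.forget =
      slideRight a.forget (l.map Strand.forget) (m.map Strand.forget) (r.map Strand.forget) := by
  induction m with
  | nil => intro l r; rfl
  | cons b m ih => intro l r; simp [slideRight, ih, Layer.forget, Piece.forget]

theorem slideLeft_forget {κ : Type} (a : Strand κ) (m : List (Strand κ)) : ∀ l r,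
    (slideLeft a l m r).map Layer.forget =
      slideLeft a.forget (l.map Strand.forget) (m.map Strand.forget) (r.map Strand.forget) := by
  induction m with
  | nil => intro l r; rfl
  | cons b m ih => intro l r; simp [slideLeft, ih, Layer.forget, Piece.forget]

theorem Layer.double_forget {κ : Type} (L : Layer κ) :
    L.forget.double = L.double.map Layer.forget := by
  obtain ⟨l, p, r⟩ := L
  cases p <;>
    simp [Layer.forget, Layer.double, Piece.forget, Piece.mirror, Piece.src, Piece.tgt,
      slideRight_forget, slideLeft_forget, Strand.forget_flip]

theorem Diagram.double_forget {κ : Type} (D : Diagram κ) : D.forget.double = D.double.forget := by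
  have : D.forget.double.layers = D.double.forget.layers := by
    simp [Diagram.forget, Diagram.double, VirtualDiagram.forget, List.flatMap_map,
      List.map_flatMap, Layer.double_forget]
  -- The layers agree and all other fields are proofs.
  generalize D.forget.double = A at *
  generalize D.double.forget = B at *
  obtain ⟨⟨_, _⟩, _⟩ := A
  obtain ⟨⟨_, _⟩, _⟩ := B
  simp only at this
  subst this
  rfl

/-! ### A state sum -/

/-- A state of a strand: a parity that changes at classical crossings, and a sheet that changes at
bars. -/
abbrev State : Type := Bool × Bool

/-- The state after a crossing of the given type. -/
def CrossingType.act : CrossingType → State → State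
  | .virt, x => x
  | _, x => (!x.1, x.2)

/-- The state after a bar. -/
def State.turn (x : State) : State := (x.1, !x.2)

variable {R : Type} [CommRing R]

/-- The sum of a function over all states. -/
def sumStates (f : State → R) : R :=
  f (false, false) + f (false, true) + f (true, false) + f (true, true)

theorem mul_sumStates (r : R) (f : State → R) :
    r * sumStates f = sumStates fun x => r * f x := by
  simp only [sumStates]; ring

/-- The weight of a crossing: `t` (at a positive crossing) or `s` (at a negative one) if the
crossing is classical, the sheets differ, and the parities of the incoming strands differ. -/
def crossWeight (t s : R) (o : CrossingType) (p q : Bool) (x y : State) : R :=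
  match o with
  | .virt => 1
  -- `x` and `y` are the states at the bottom. A downward strand enters at the top, where its parity
  -- is the opposite one, so `x.1 ^^ y.1 ^^ p ^^ q` compares the incoming parities. The crossing
  -- changes its sign when the strands run in opposite vertical directions, that is, when `p ^^ q`.
  | .over => if (x.2 ^^ y.2) && (x.1 ^^ y.1 ^^ p ^^ q) then (if p ^^ q then s else t) else 1
  | .under => if (x.2 ^^ y.2) && (x.1 ^^ y.1 ^^ p ^^ q) then (if p ^^ q then t else s) else 1

/-- The contribution of an elementary piece to the state sum. -/
def pieceSum (t s : R) : Piece Unit → (List State → R) → List State → R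
  | .cup _, F, c => sumStates fun x => F (x :: x :: c)
  | .cap _, F, x :: y :: c => if x = y then F c else 0
  | .cross o a b, F, x :: y :: c =>
      crossWeight t s o a.up b.up x y * F (o.act y :: o.act x :: c)
  | .bar _, F, x :: c => F (x.turn :: c)
  -- Too few states for the piece; this does not occur along a path with a state list of the right
  -- length.
  | _, _, _ => 0

/-- The contribution of a layer to the state sum. -/
def layerSum (t s : R) (L : Layer Unit) (F : List State → R) (c : List State) : R :=
  pieceSum t s L.piece (fun d => F (c.take L.left.length ++ d)) (c.drop L.left.length)

/-- The state sum of a sequence of layers, as an operator on functions of the states. -/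
def stateSum (t s : R) : List (Layer Unit) → (List State → R) → List State → R
  | [], F => F
  | L :: w, F => layerSum t s L (stateSum t s w F)

theorem stateSum_append (t s : R) (w w' : List (Layer Unit)) (F : List State → R) :
    stateSum t s (w ++ w') F = stateSum t s w (stateSum t s w' F) := by
  induction w with
  | nil => rfl
  | cons L w ih => simp [stateSum, ih]

/-- Strands on the left are spectators, carried along in the prefix `d`. Strands on the right need
no counterpart, because `c` may have any tail. -/
theorem stateSum_widen (t s : R) (l r : List (Strand Unit)) (w : List (Layer Unit))
    (F : List State → R) (d : List State) (hd : d.length = l.length) : ∀ c,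
    stateSum t s (w.map (Layer.widen l r)) F (d ++ c) =
      stateSum t s w (fun c => F (d ++ c)) c := by
  induction w with
  | nil => intro c; rfl
  | cons L w ih =>
    intro c
    simp only [List.map_cons, stateSum, layerSum, Layer.widen, List.length_append, ← hd,
      List.take_length_add_append, List.drop_length_add_append, List.append_assoc, ih]

theorem pieceSum_congr (t s : R) (p : Piece Unit) {F G : List State → R} (n : ℕ)
    (h : ∀ c, c.length = n + p.tgt.length → F c = G c) (c : List State)
    (hc : c.length = n + p.src.length) : pieceSum t s p F c = pieceSum t s p G c := by
  cases p with
  | cup a =>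
    have : (fun x : State => F (x :: x :: c)) = fun x => G (x :: x :: c) := by
      funext x
      apply h
      simpa [Piece.src, Piece.tgt] using hc
    simp only [pieceSum, this]
  | _ =>
    rcases c with _ | ⟨x, _ | ⟨y, c⟩⟩ <;> simp_all [pieceSum, Piece.src, Piece.tgt]

/-- Allows the part above a given height to be compared only on lists with one state per strand. -/
theorem stateSum_congr (t s : R) (w : List (Layer Unit)) : ∀ {a b : List (Strand Unit)},
    IsPath a w b → ∀ {F G : List State → R}, (∀ c, c.length = b.length → F c = G c) →
    ∀ c, c.length = a.length → stateSum t s w F c = stateSum t s w G c := by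
  induction w with
  | nil => rintro a b rfl F G h c hc; exact h c hc
  | cons L w ih =>
    rintro a b ⟨rfl, hw⟩ F G h c hc
    refine pieceSum_congr t s L.piece L.right.length (fun d hd => ih hw h _ ?_) _ ?_
    · simp [Layer.src, Layer.tgt] at hc ⊢; omega
    · simp [Layer.src] at hc ⊢; omega

end TwistedLinks

namespace TwistedLinks
variable {R : Type} [CommRing R]

/-! ### Crossing weights and invariance of the state sum under each move -/

theorem crossWeight_act (t s : R) (o o' : CrossingType) (p q : Bool) (x y : State) :
    crossWeight t s o p q (o'.act x) (o'.act y) = crossWeight t s o p q x y := by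
  cases o' <;> cases o <;> simp [crossWeight, CrossingType.act]

theorem crossWeight_turn (t s : R) (o : CrossingType) (p q : Bool) (x y : State) :
    crossWeight t s o p q x.turn y.turn = crossWeight t s o p q x y := by
  cases o <;> simp [crossWeight, State.turn]

theorem crossWeight_swap (t s : R) (o : CrossingType) (p q : Bool) (x y : State) :
    crossWeight t s o q p y x = crossWeight t s o p q x y := by
  cases o <;> simp [crossWeight, Bool.xor_comm, Bool.xor_left_comm]

theorem crossWeight_mul_inv {t s : R} (hts : t * s = 1) (o : CrossingType) (p q : Bool)
    (x y : State) : crossWeight t s o p q x y * crossWeight t s o.inv p q x y = 1 := by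
  have hst : s * t = 1 := by rw [mul_comm, hts]
  cases o <;> simp only [crossWeight, CrossingType.inv] <;>
    (try split_ifs) <;> simp [hts, hst]

/-- When the crossing is turned, one strand is read from its other end, with opposite direction and
with the state beyond the crossing. The incoming parities, the sheets and the sign are intrinsic, so
the weight is unchanged. -/
theorem crossWeight_rotate (t s : R) (o : CrossingType) (p q : Bool) (x y : State) :
    crossWeight t s o.inv q (!p) y (o.act x) = crossWeight t s o p q x y := by
  obtain ⟨x, x'⟩ := x
  obtain ⟨y, y'⟩ := y
  cases o <;> simp only [crossWeight, CrossingType.inv, CrossingType.act] <;>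
    cases p <;> cases q <;> simp [Bool.xor_comm]

theorem crossWeight_rotate' (t s : R) (o : CrossingType) (p q : Bool) (x y : State) :
    crossWeight t s o.inv (!p) q (o.act x) y = crossWeight t s o q p y x := by
  obtain ⟨x, x'⟩ := x
  obtain ⟨y, y'⟩ := y
  cases o <;> simp only [crossWeight, CrossingType.inv, CrossingType.act] <;>
    cases p <;> cases q <;> simp [Bool.xor_comm]

/-- No bar lies on a kink, so both passages are on the same sheet. This is why the weight requires
different sheets. -/
theorem crossWeight_kink (t s : R) (o : CrossingType) (p : Bool) (x y : State)
    (h : o.act x = y) : crossWeight t s o p p x y = 1 := by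
  subst h
  cases o <;> simp [crossWeight, CrossingType.act]

theorem sumStates_act (o : CrossingType) (f : State → R) :
    (sumStates fun x => f (o.act x)) = sumStates f := by
  cases o <;> simp only [sumStates, CrossingType.act, Bool.not_false, Bool.not_true]
  all_goals ring

theorem sumStates_ite_eq (x : State) (f : State → R) :
    (sumStates fun y => if x = y then f y else 0) = f x := by
  rcases x with ⟨_ | _, _ | _⟩ <;>
    simp only [sumStates, Prod.mk.injEq, Bool.false_eq_true, Bool.true_eq_false, and_true,
      and_false, if_true, if_false, add_zero, zero_add, and_self]

theorem sumStates_ite_eq' (x : State) (f : State → R) :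
    (sumStates fun y => if y = x then f y else 0) = f x := by
  rcases x with ⟨_ | _, _ | _⟩ <;>
    simp only [sumStates, Prod.mk.injEq, Bool.false_eq_true, Bool.true_eq_false, and_true,
      and_false, if_true, if_false, add_zero, zero_add, and_self]

theorem CrossingType.act_act (o : CrossingType) (x : State) : o.act (o.act x) = x := by
  cases o <;> simp [CrossingType.act]

theorem CrossingType.act_inv (o : CrossingType) (x : State) : o.inv.act x = o.act x := by
  cases o <;> rfl

theorem CrossingType.act_turn (o : CrossingType) (x : State) :
    o.act x.turn = (o.act x).turn := by
  cases o <;> rfl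

theorem CrossingType.act_comm (o o' : CrossingType) (x : State) :
    o.act (o'.act x) = o'.act (o.act x) := by
  cases o <;> cases o' <;> rfl

/-- In a triangle move the third strand meets the two strands of a classical crossing either both
classically or both virtually. Hence both parities change or neither does, and their difference is
kept. -/
theorem crossWeight_act_act (t s : R) {o o₁ o₂ : CrossingType}
    (h : o = .virt ∨ (o₁ = .virt ↔ o₂ = .virt)) (p q : Bool) (x y : State) :
    crossWeight t s o p q (o₁.act x) (o₂.act y) = crossWeight t s o p q x y := by
  cases o <;> cases o₁ <;> cases o₂ <;> simp [crossWeight, CrossingType.act] at h ⊢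

theorem TriangleMove.virt_iff {x y z : CrossingType} (h : TriangleMove x y z) :
    (x = .virt ∨ (y = .virt ↔ z = .virt)) ∧ (y = .virt ∨ (x = .virt ↔ z = .virt)) ∧
      (z = .virt ∨ (x = .virt ↔ y = .virt)) := by
  cases x <;> cases y <;> cases z <;> simp [TriangleMove] at h ⊢

theorem State.turn_turn (x : State) : x.turn.turn = x := by simp [State.turn]

theorem sumStates_turn (f : State → R) : (sumStates fun x => f x.turn) = sumStates f := by
  simp only [sumStates, State.turn, Bool.not_false, Bool.not_true]
  ring

/-- Each piece acts on its own strands as a finite matrix, so that exchanging the heights of two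
distant pieces amounts to exchanging two finite sums. -/
theorem pieceSum_eq_sum (t s : R) (p : Piece Unit) (d : List State)
    (hd : d.length = p.src.length) : ∃ (n : ℕ) (k : Fin n → R) (o : Fin n → List State),
      (∀ i, (o i).length = p.tgt.length) ∧
        ∀ F c, pieceSum t s p F (d ++ c) = ∑ i, k i * F (o i ++ c) := by
  cases p with
  | cup a =>
    obtain rfl := List.length_eq_zero_iff.1 hd
    refine ⟨4, fun _ => 1, ![[(false, false), (false, false)], [(false, true), (false, true)],
      [(true, false), (true, false)], [(true, true), (true, true)]], ?_, fun F c => ?_⟩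
    · intro i; fin_cases i <;> rfl
    · simp [pieceSum, sumStates, Fin.sum_univ_four]
  | cap a =>
    obtain ⟨x, y, rfl⟩ := List.length_eq_two.1 hd
    exact ⟨1, fun _ => if x = y then 1 else 0, fun _ => [], fun _ => rfl, fun F c => by
      simp [pieceSum]⟩
  | cross o a b =>
    obtain ⟨x, y, rfl⟩ := List.length_eq_two.1 hd
    exact ⟨1, fun _ => crossWeight t s o a.up b.up x y, fun _ => [o.act y, o.act x],
      fun _ => rfl, fun F c => by simp [pieceSum]⟩
  | bar a =>
    obtain ⟨x, rfl⟩ := List.length_eq_one_iff.1 hd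
    exact ⟨1, fun _ => 1, fun _ => [x.turn], fun _ => rfl, fun F c => by simp [pieceSum]⟩

theorem pieceSum_comm (t s : R) (g h : Piece Unit) (m d e c : List State)
    (hd : d.length = g.src.length) (he : e.length = h.src.length) (F : List State → R) :
    pieceSum t s g (fun b => pieceSum t s h
        (fun b' => F (b.take (g.tgt.length + m.length) ++ b'))
        (b.drop (g.tgt.length + m.length))) (d ++ (m ++ (e ++ c))) =
    pieceSum t s h (fun b => pieceSum t s g F (d ++ (m ++ b))) (e ++ c) := by
  obtain ⟨n, k, o, ho, hg⟩ := pieceSum_eq_sum t s g d hd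
  obtain ⟨n', k', o', ho', hh⟩ := pieceSum_eq_sum t s h e he
  have key : ∀ i (b : List State), (o i ++ (m ++ b)).take (g.tgt.length + m.length) = o i ++ m ∧
      (o i ++ (m ++ b)).drop (g.tgt.length + m.length) = b := by
    intro i b
    rw [← ho i, ← List.length_append, ← List.append_assoc]
    exact ⟨List.take_left, List.drop_left⟩
  simp only [hg, hh, (key _ _).1, (key _ _).2, Finset.mul_sum, List.append_assoc]
  rw [Finset.sum_comm]
  exact Finset.sum_congr rfl fun _ _ => Finset.sum_congr rfl fun _ _ => by ring

theorem Isotopy.stateSum_eq {t s : R} {u v : List (Layer Unit)}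
    (h : Isotopy u v) {a b : List (Strand Unit)} (hu : IsPath a u b) (F : List State → R)
    (c d : List State) (hc : c.length = a.length) :
    stateSum t s u F (c ++ d) = stateSum t s v F (c ++ d) := by
  cases h with
  | exchange g h m =>
    obtain ⟨rfl, -⟩ := hu
    obtain ⟨c₁, c', rfl, h₁, h'⟩ : ∃ c₁ c', c = c₁ ++ c' ∧ c₁.length = g.src.length ∧
        c'.length = m.length + h.src.length :=
      ⟨c.take g.src.length, c.drop g.src.length, (List.take_append_drop _ _).symm, by
        simp [Layer.src] at hc ⊢; omega, by simp [Layer.src] at hc ⊢; omega⟩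
    obtain ⟨c₂, c₃, rfl, h₂, h₃⟩ : ∃ c₂ c₃, c' = c₂ ++ c₃ ∧ c₂.length = m.length ∧
        c₃.length = h.src.length :=
      ⟨c'.take m.length, c'.drop m.length, (List.take_append_drop _ _).symm, by
        simp at h' ⊢; omega, by simp at h' ⊢; omega⟩
    have := pieceSum_comm t s g h c₂ c₁ c₃ d h₁ h₃ F
    have e : (c₁ ++ (c₂ ++ (c₃ ++ d))).take (g.src.length + m.length) = c₁ ++ c₂ ∧
        (c₁ ++ (c₂ ++ (c₃ ++ d))).drop (g.src.length + m.length) = c₃ ++ d := by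
      rw [← h₁, ← h₂, ← List.length_append, ← List.append_assoc]
      exact ⟨List.take_left, List.drop_left⟩
    simpa [stateSum, layerSum, h₂, e.1, e.2] using this
  | zigzag_right a =>
    obtain ⟨rfl, -⟩ := hu
    obtain ⟨x, rfl⟩ := List.length_eq_one_iff.1 hc
    simp [stateSum, layerSum, pieceSum, sumStates_ite_eq]
  | zigzag_left a =>
    obtain ⟨rfl, -⟩ := hu
    obtain ⟨x, rfl⟩ := List.length_eq_one_iff.1 hc
    simp [stateSum, layerSum, pieceSum, sumStates_ite_eq']
  | cross_cap o a b =>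
    obtain ⟨rfl, -⟩ := hu
    obtain ⟨x, y, z, rfl⟩ := List.length_eq_three.1 hc
    have e : o.act x = z ↔ x = o.act z := by
      constructor <;> rintro rfl <;> simp [CrossingType.act_act]
    have := crossWeight_rotate t s o a.up b.up x y
    by_cases hz : x = o.act z
    · have hz' := e.2 hz
      subst hz'
      simp [stateSum, layerSum, pieceSum, CrossingType.act_inv, CrossingType.act_act,
        Strand.flip, this]
    · simp [stateSum, layerSum, pieceSum, CrossingType.act_inv, e, hz]
  | cross_cup o a b =>
    obtain ⟨rfl, -⟩ := hu
    obtain ⟨y, rfl⟩ := List.length_eq_one_iff.1 hc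
    have e := fun x => crossWeight_rotate' t s o a.up b.up x y
    have := sumStates_act o fun x =>
      crossWeight t s o.inv (!a.up) b.up x y * F (x :: o.act y :: o.act x :: d)
    simpa [stateSum, layerSum, pieceSum, Strand.flip, CrossingType.act_inv, o.act_act, e] using this
  | bar_cap a =>
    obtain ⟨rfl, -⟩ := hu
    obtain ⟨x, y, rfl⟩ := List.length_eq_two.1 hc
    have e : x.turn = y ↔ x = y.turn := by
      constructor <;> rintro rfl <;> simp [State.turn_turn]
    simp [stateSum, layerSum, pieceSum, e]
  | bar_cup a =>
    obtain ⟨rfl, -⟩ := hu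
    obtain rfl := List.length_eq_zero_iff.1 hc
    have := sumStates_turn fun x => F (x :: x.turn :: d)
    simpa [stateSum, layerSum, pieceSum, State.turn_turn] using this

theorem Generalized.stateSum_eq {t s : R} (hts : t * s = 1) {u v : List (Layer Unit)}
    (h : Generalized u v) {a b : List (Strand Unit)} (hu : IsPath a u b) (F : List State → R)
    (c d : List State) (hc : c.length = a.length) :
    stateSum t s u F (c ++ d) = stateSum t s v F (c ++ d) := by
  cases h with
  | one_right o a =>
    obtain ⟨rfl, -⟩ := hu
    obtain ⟨x, rfl⟩ := List.length_eq_one_iff.1 hc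
    have e : stateSum t s [⟨[a], .cup a, []⟩, ⟨[], .cross o a a, [a.flip]⟩, ⟨[a], .cap a, []⟩] F
        (x :: d) = sumStates fun y => if o.act x = y then
          crossWeight t s o a.up a.up x y * F (o.act y :: d) else 0 := by
      simp [stateSum, layerSum, pieceSum]
    simpa [sumStates_ite_eq, crossWeight_kink, o.act_act, stateSum] using e
  | one_left o a =>
    obtain ⟨rfl, -⟩ := hu
    obtain ⟨x, rfl⟩ := List.length_eq_one_iff.1 hc
    have h' : ∀ y, y = o.act x ↔ o.act y = x := fun y => by
      constructor <;> rintro rfl <;> simp [o.act_act]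
    have e : stateSum t s [⟨[], .cup a.flip, [a]⟩, ⟨[a.flip], .cross o a a, []⟩,
        ⟨[], .cap a.flip, [a]⟩] F (x :: d) = sumStates fun y => if y = o.act x then
          crossWeight t s o a.up a.up y x * F (o.act y :: d) else 0 := by
      simp [stateSum, layerSum, pieceSum]
    simpa [sumStates_ite_eq', crossWeight_kink, o.act_act, stateSum] using e
  | two o a b =>
    obtain ⟨rfl, -⟩ := hu
    obtain ⟨x, y, rfl⟩ := List.length_eq_two.1 hc
    simp [stateSum, layerSum, pieceSum, CrossingType.act_inv, CrossingType.act_act, ← mul_assoc]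
    -- At the second crossing both parities have changed, so its weight is the inverse of the first
    -- one. Only here does `t * s = 1` enter.
    rw [crossWeight_swap, crossWeight_act, crossWeight_mul_inv hts, one_mul]
  | three o₁ o₂ o₃ h a b c =>
    obtain ⟨rfl, -⟩ := hu
    obtain ⟨x, y, z, rfl⟩ := List.length_eq_three.1 hc
    obtain ⟨h₁, h₂, h₃⟩ := h.virt_iff
    have e₁ := crossWeight_act_act t s h₁ a.up b.up x y
    have e₂ : crossWeight t s o₂ a.up c.up (o₁.act x) z =
        crossWeight t s o₂ a.up c.up x (o₃.act z) := by
      rw [← crossWeight_act_act t s h₂ a.up c.up x (o₃.act z), CrossingType.act_act]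
    have e₃ := crossWeight_act_act t s h₃ b.up c.up y z
    simp [stateSum, layerSum, pieceSum, e₁, e₂, e₃, o₂.act_comm o₁, o₃.act_comm o₁,
      o₃.act_comm o₂]
    ring

theorem Twisting.stateSum_eq {t s : R} {u v : List (Layer Unit)}
    (h : Twisting u v) {a b : List (Strand Unit)} (hu : IsPath a u b) (F : List State → R)
    (c d : List State) (hc : c.length = a.length) :
    stateSum t s u F (c ++ d) = stateSum t s v F (c ++ d) := by
  cases h with
  | one_left a b =>
    obtain ⟨rfl, -⟩ := hu
    obtain ⟨x, y, rfl⟩ := List.length_eq_two.1 hc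
    simp [stateSum, layerSum, pieceSum, crossWeight, CrossingType.act]
  | one_right a b =>
    obtain ⟨rfl, -⟩ := hu
    obtain ⟨x, y, rfl⟩ := List.length_eq_two.1 hc
    simp [stateSum, layerSum, pieceSum, crossWeight, CrossingType.act]
  | two a =>
    obtain ⟨rfl, -⟩ := hu
    obtain ⟨x, rfl⟩ := List.length_eq_one_iff.1 hc
    simp [stateSum, layerSum, pieceSum, State.turn_turn]
  | three o ho a b =>
    obtain ⟨rfl, -⟩ := hu
    obtain ⟨x, y, rfl⟩ := List.length_eq_two.1 hc
    -- The lower bars change both sheets and the upper bars change them back, so the comparison of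
    -- sheets at the crossing is not affected. On the other side the strands have changed places,
    -- and the crossing keeps its sign.
    simp [stateSum, layerSum, pieceSum, CrossingType.act_turn, State.turn_turn, crossWeight_turn]
    simp [CrossingType.act, crossWeight_swap t s o b.up]
    simp [crossWeight, Bool.xor_comm]
end TwistedLinks

namespace TwistedLinks

/-! ### The state sum as an invariant of unordered twisted links -/

theorem IsPath.split {κ : Type} {w w' : List (Layer κ)} : ∀ {a b : List (Strand κ)},
    IsPath a (w ++ w') b → ∃ m, IsPath a w m ∧ IsPath m w' b := by
  induction w with
  | nil => intro a b h; exact ⟨a, rfl, h⟩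
  | cons L w ih =>
    rintro a b ⟨h, h'⟩
    obtain ⟨m, h₁, h₂⟩ := ih h'
    exact ⟨m, ⟨h, h₁⟩, h₂⟩

theorem Isotopy.isPath {κ : Type} {u v : List (Layer κ)} (h : Isotopy u v) :
    u ≠ [] ∧ ∃ a b, IsPath a u b := by
  cases h <;>
    simp [IsPath, Layer.src, Layer.tgt, Piece.src, Piece.tgt, Strand.flip]

theorem Generalized.isPath {κ : Type} {u v : List (Layer κ)} (h : Generalized u v) :
    u ≠ [] ∧ ∃ a b, IsPath a u b := by
  cases h <;>
    simp [IsPath, Layer.src, Layer.tgt, Piece.src, Piece.tgt, Strand.flip]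

theorem Twisting.isPath {κ : Type} {u v : List (Layer κ)} (h : Twisting u v) :
    u ≠ [] ∧ ∃ a b, IsPath a u b := by
  cases h <;>
    simp [IsPath, Layer.src, Layer.tgt, Piece.src, Piece.tgt]

variable {R : Type} [CommRing R]

/-- The state sum of a diagram. -/
def Diagram.stateSum (t s : R) (D : Diagram Unit) : R :=
  TwistedLinks.stateSum t s D.layers (fun _ => 1) []

theorem Replace.stateSum_eq {t s : R} {T : List (Layer Unit) → List (Layer Unit) → Prop}
    (hT : ∀ u v, T u v → u ≠ [] ∧ ∃ a b, IsPath a u b)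
    (hS : ∀ u v, T u v → ∀ a b, IsPath a u b → ∀ (F : List State → R) (c d : List State),
      c.length = a.length → stateSum t s u F (c ++ d) = stateSum t s v F (c ++ d))
    {D E : Diagram Unit} (h : Replace T D E) : D.stateSum t s = E.stateSum t s := by
  obtain ⟨p, q, u, v, l, r, huv, hD, hE⟩ := h
  have hc := D.closed
  rw [hD, List.append_assoc] at hc
  obtain ⟨m, hp, hu⟩ := hc.split
  obtain ⟨hne, a, b, hab⟩ := hT u v huv
  -- The left side of every move is nonempty, so its first layer determines the strands at the
  -- height where the replaced part begins.
  have hm : m = l ++ a ++ r := by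
    rcases u with _ | ⟨L, u⟩
    · exact (hne rfl).elim
    · rw [← hu.1, ← hab.1]
      simp [Layer.widen, Layer.src]
  subst hm
  simp only [Diagram.stateSum, hD, hE, List.append_assoc, stateSum_append]
  refine stateSum_congr t s p hp (fun c hc => ?_) [] rfl
  simp only [List.length_append] at hc
  obtain ⟨c₁, c₂, c₃, rfl, h₁, h₂⟩ : ∃ c₁ c₂ c₃, c = c₁ ++ (c₂ ++ c₃) ∧ c₁.length = l.length ∧
      c₂.length = a.length :=
    ⟨c.take l.length, (c.drop l.length).take a.length, (c.drop l.length).drop a.length, by simp,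
      by simp; omega, by simp; omega⟩
  rw [stateSum_widen t s l r u _ c₁ h₁, stateSum_widen t s l r v _ c₁ h₁]
  exact hS u v huv a b hab _ c₂ c₃ h₂

theorem UnorderedEquiv.stateSum_eq {t s : R} (hts : t * s = 1) {D E : Diagram Unit}
    (h : UnorderedEquiv D E) : D.stateSum t s = E.stateSum t s := by
  induction h with
  | rel D E h =>
    rcases h with h | h | h
    · exact h.stateSum_eq (fun _ _ => Isotopy.isPath) fun _ _ h _ _ => h.stateSum_eq
    · exact h.stateSum_eq (fun _ _ => Generalized.isPath) fun _ _ h _ _ => h.stateSum_eq hts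
    · exact h.stateSum_eq (fun _ _ => Twisting.isPath) fun _ _ h _ _ => h.stateSum_eq
  | refl => rfl
  | symm _ _ _ ih => exact ih.symm
  | trans _ _ _ _ _ ih ih' => exact ih.trans ih'

end TwistedLinks

namespace TwistedLinks

/-! ### Decidability -/

instance {κ : Type} [DecidableEq κ] : DecidableEq (Strand κ)
  | ⟨c, d⟩, ⟨c', d'⟩ => decidable_of_iff (d = d' ∧ c = c') (by simp [and_comm])

instance : DecidableEq CrossingType
  | .over, .over => isTrue rfl
  | .under, .under => isTrue rfl
  | .virt, .virt => isTrue rfl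
  | .over, .under => isFalse nofun
  | .over, .virt => isFalse nofun
  | .under, .over => isFalse nofun
  | .under, .virt => isFalse nofun
  | .virt, .over => isFalse nofun
  | .virt, .under => isFalse nofun

instance {κ : Type} [DecidableEq κ] : DecidableEq (Piece κ)
  | .cup a, .cup b => decidable_of_iff (a = b) (by simp)
  | .cap a, .cap b => decidable_of_iff (a = b) (by simp)
  | .bar a, .bar b => decidable_of_iff (a = b) (by simp)
  | .cross x a b, .cross y c d => decidable_of_iff (x = y ∧ a = c ∧ b = d) (by simp)
  | .cup _, .cap _ => isFalse nofun
  | .cup _, .bar _ => isFalse nofun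
  | .cup _, .cross _ _ _ => isFalse nofun
  | .cap _, .cup _ => isFalse nofun
  | .cap _, .bar _ => isFalse nofun
  | .cap _, .cross _ _ _ => isFalse nofun
  | .bar _, .cup _ => isFalse nofun
  | .bar _, .cap _ => isFalse nofun
  | .bar _, .cross _ _ _ => isFalse nofun
  | .cross _ _ _, .cup _ => isFalse nofun
  | .cross _ _ _, .cap _ => isFalse nofun
  | .cross _ _ _, .bar _ => isFalse nofun

instance {κ : Type} [DecidableEq κ] : DecidableEq (Layer κ)
  | ⟨l, p, r⟩, ⟨l', p', r'⟩ => decidable_of_iff (p = p' ∧ l = l' ∧ r = r') (by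
      simp only [Layer.mk.injEq]; tauto)

instance decidableIsPath {κ : Type} [DecidableEq κ] : ∀ (s : List (Strand κ))
    (w : List (Layer κ)) (t : List (Strand κ)), Decidable (IsPath s w t)
  | s, [], t => inferInstanceAs (Decidable (s = t))
  | _, L :: w, t =>
    have := decidableIsPath L.tgt w t
    inferInstanceAs (Decidable (_ ∧ _))

instance {κ : Type} : ∀ p : Piece κ, Decidable p.NotBar
  | .bar _ => isFalse id
  | .cup _ => isTrue trivial
  | .cap _ => isTrue trivial
  | .cross _ _ _ => isTrue trivial

/-! ### Following a component of a diagram -/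

/-- The pairs of points joined by an arc inside the layer between the heights `k` and `k + 1`. -/
def Layer.edges {κ : Type} (k : ℕ) (L : Layer κ) : List ((ℕ × ℕ) × (ℕ × ℕ)) :=
  (List.range L.left.length).map (fun i => ((k, i), (k + 1, i))) ++
    (List.range L.right.length).map (fun i => ((k, L.left.length + L.piece.src.length + i),
      (k + 1, L.left.length + L.piece.tgt.length + i))) ++
    match L.piece with
    | .cup _ => [((k + 1, L.left.length), (k + 1, L.left.length + 1))]
    | .cap _ => [((k, L.left.length), (k, L.left.length + 1))]
    | .cross _ _ _ => [((k, L.left.length), (k + 1, L.left.length + 1)),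
        ((k, L.left.length + 1), (k + 1, L.left.length))]
    | .bar _ => [((k, L.left.length), (k + 1, L.left.length))]

theorem Diagram.joined_of_mem_edges {κ : Type} (D : Diagram κ) {k : ℕ} {L : Layer κ}
    (hL : D.layers[k]? = some L) {e : (ℕ × ℕ) × (ℕ × ℕ)} (he : e ∈ L.edges k) :
    D.Joined e.1 e.2 := by
  simp only [Layer.edges, List.mem_append, List.mem_map, List.mem_range] at he
  rcases he with (⟨i, hi, rfl⟩ | ⟨i, hi, rfl⟩) | he
  · exact .left k i L hL hi
  · exact .right k i L hL hi
  · obtain ⟨l, p, r⟩ := L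
    cases p with
    | cup a => obtain rfl := List.mem_singleton.1 he; exact .cup k l r a hL
    | cap a => obtain rfl := List.mem_singleton.1 he; exact .cap k l r a hL
    | bar a => obtain rfl := List.mem_singleton.1 he; exact .bar k l r a hL
    | cross x a b =>
      rcases List.mem_cons.1 he with rfl | he
      · exact .cross_left k l r x a b hL
      · obtain rfl := List.mem_singleton.1 he
        exact .cross_right k l r x a b hL

/-- The points joined to a given point inside the layer between the heights `k` and `k + 1`. -/
def Diagram.neighborsIn {κ : Type} (D : Diagram κ) (k : ℕ) (p : ℕ × ℕ) : List (ℕ × ℕ) :=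
  (((D.layers[k]?).map (Layer.edges k)).getD []).filterMap fun e =>
    if e.1 = p then some e.2 else if e.2 = p then some e.1 else none

/-- The points joined to a given point. -/
def Diagram.neighbors {κ : Type} (D : Diagram κ) (p : ℕ × ℕ) : List (ℕ × ℕ) :=
  D.neighborsIn p.1 p ++ D.neighborsIn (p.1 - 1) p

theorem Diagram.eqvGen_of_mem_neighbors {κ : Type} (D : Diagram κ) {p q : ℕ × ℕ}
    (h : q ∈ D.neighbors p) : Relation.EqvGen D.Joined p q := by
  have key : ∀ k, q ∈ D.neighborsIn k p → Relation.EqvGen D.Joined p q := by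
    intro k hk
    obtain ⟨e, he, hq⟩ := List.mem_filterMap.1 hk
    cases hL : D.layers[k]? with
    | none => simp [hL] at he
    | some L =>
      have hj := D.joined_of_mem_edges hL (by simpa [hL] using he)
      split_ifs at hq with h₁ h₂
      · obtain rfl := Option.some.inj hq
        exact h₁ ▸ .rel _ _ hj
      · obtain rfl := Option.some.inj hq
        exact h₂ ▸ .symm _ _ (.rel _ _ hj)
  rcases List.mem_append.1 h with h | h
  · exact key _ h
  · exact key _ h

/-- The first points met when one follows a component, from the point `p`, reached from `o`. -/
def Diagram.walk {κ : Type} (D : Diagram κ) : ℕ → ℕ × ℕ → ℕ × ℕ → List (ℕ × ℕ)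
  | 0, _, _ => []
  | n + 1, o, p => p :: match (D.neighbors p).find? (fun q => q ≠ o) with
    | none => []
    | some q => D.walk n p q

theorem Diagram.eqvGen_of_mem_walk {κ : Type} (D : Diagram κ) (n : ℕ) : ∀ {o p q : ℕ × ℕ},
    q ∈ D.walk n o p → Relation.EqvGen D.Joined p q := by
  induction n with
  | zero => intro o p q h; simp [walk] at h
  | succ n ih =>
    intro o p q h
    rcases List.mem_cons.1 h with rfl | h
    · exact .refl _
    · split at h
      · simp at h
      · rename_i p' hp'
        exact .trans _ _ _ (D.eqvGen_of_mem_neighbors (List.mem_of_find?_eq_some hp')) (ih h)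

theorem Diagram.level_eq_nil {κ : Type} (D : Diagram κ) {k : ℕ} (hk : D.layers.length < k) :
    D.level k = [] := by
  cases k with
  | zero => rfl
  | succ k => simp [level, List.getElem?_eq_none (Nat.le_of_lt_succ hk)]

/-- A diagram whose colours are `1, …, m` and for which following the component from the point
`start c` for `n` steps meets all points of colour `c` is ordered. -/
def OrderedDiagram.ofWalk (D : Diagram ℕ) (m n : ℕ) (start : ℕ → ℕ × ℕ)
    (hcolor : ∀ k < D.layers.length + 1, ∀ a ∈ D.level k, 1 ≤ a.color ∧ a.color ≤ m)
    (hmem : ∀ c ∈ List.range m,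
      ((D.level (start (c + 1)).1)[(start (c + 1)).2]?).map Strand.color = some (c + 1))
    (hwalk : ∀ c ∈ List.range m, ∀ k < D.layers.length + 1, ∀ a ∈ (D.level k).zipIdx,
      a.1.color = c + 1 → (k, a.2) ∈ D.walk n (0, 0) (start (c + 1))) : OrderedDiagram where
  toDiagram := D
  numComponents := m
  numbers := by
    intro c
    constructor
    · rintro ⟨k, a, ha, rfl⟩
      by_cases hk : k < D.layers.length + 1
      · exact hcolor k hk a ha
      · rw [D.level_eq_nil (by omega)] at ha
        simp at ha
    · rintro ⟨h₁, h₂⟩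
      obtain ⟨c, rfl⟩ : ∃ c', c = c' + 1 := ⟨c - 1, by omega⟩
      obtain ⟨a, ha, hc⟩ := Option.map_eq_some_iff.1 (hmem c (List.mem_range.2 (by omega)))
      exact ⟨_, a, List.mem_of_getElem? ha, hc⟩
  one_component := by
    have key : ∀ (k i : ℕ) (a : Strand ℕ), (D.level k)[i]? = some a →
        Relation.EqvGen D.Joined (start a.color) (k, i) := by
      intro k i a ha
      by_cases hk : k < D.layers.length + 1
      · obtain ⟨h₁, h₂⟩ := hcolor k hk a (List.mem_of_getElem? ha)
        have := hwalk (a.color - 1) (List.mem_range.2 (by omega)) k hk (a, i)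
          (List.mk_mem_zipIdx_iff_getElem?.2 ha) (by simp only; omega)
        rw [show a.color - 1 + 1 = a.color by omega] at this
        exact D.eqvGen_of_mem_walk n this
      · rw [D.level_eq_nil (by omega)] at ha
        simp at ha
    intro k k' i i' a a' ha ha' h
    exact .trans _ _ _ (.symm _ _ (key k i a ha)) (h ▸ key k' i' a' ha')

/-! ### Diagrams in which all strands are doubled -/

section Parallel
variable {κ : Type}

/-- Two parallel local minima. -/
def parallelCup (l : List (Strand κ)) (a : Strand κ) (r : List (Strand κ)) : List (Layer κ) :=
  [⟨l, .cup a, r⟩, ⟨l ++ [a], .cup a, a.flip :: r⟩]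

/-- Two parallel local maxima. -/
def parallelCap (l : List (Strand κ)) (a : Strand κ) (r : List (Strand κ)) : List (Layer κ) :=
  [⟨l ++ [a], .cap a, a.flip :: r⟩, ⟨l, .cap a, r⟩]

/-- Two parallel copies of a crossing, whose strands meet otherwise in virtual crossings. -/
def parallelCross (x : CrossingType) (l : List (Strand κ)) (a b : Strand κ)
    (r : List (Strand κ)) : List (Layer κ) :=
  [⟨l ++ [a], .cross .virt a b, b :: r⟩, ⟨l, .cross x a b, a :: b :: r⟩,
    ⟨l ++ [b, a], .cross x a b, r⟩, ⟨l ++ [b], .cross .virt a b, a :: r⟩]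

/-- Bars on two parallel strands at the left. -/
def parallelBar (a : Strand κ) (r : List (Strand κ)) : List (Layer κ) :=
  [⟨[], .bar a, a :: r⟩, ⟨[a], .bar a, r⟩]

/-- Two parallel strands are interchanged. -/
def interchange (l : List (Strand κ)) (a : Strand κ) (r : List (Strand κ)) : List (Layer κ) :=
  [⟨l, .cross .virt a a, r⟩]

end Parallel

/-- Take a figure-eight curve with one crossing and a bar on each of its two loops, and a circle
that links the second loop once, meeting it in a classical and in a virtual crossing. These are the
layers of a double cover of this diagram, with two components; `left` and `right` tell whether the
two copies of the first and of the second loop are interchanged. -/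
def coverLayers (left right : Bool) : List (Layer ℕ) :=
  let a : Strand ℕ := ⟨1, true⟩
  let b : Strand ℕ := ⟨1, false⟩
  let z : Strand ℕ := ⟨2, true⟩
  let y : Strand ℕ := ⟨2, false⟩
  parallelCup [] a [] ++ parallelBar a [b, b] ++ (bif right then interchange [] a [b, b] else []) ++
    parallelCup [a, a] z [b, b] ++ parallelCross .over [] a z [y, y, b, b] ++
    parallelCross .virt [] z a [y, y, b, b] ++ interchange [a, a] z [y, y, b, b] ++
    parallelCap [a, a] z [b, b] ++ parallelCup [] b [a, a, b, b] ++
    parallelCross .over [b, b] a a [b, b] ++ parallelBar b [a, a, a, a, b, b] ++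
    (bif left then interchange [] b [a, a, a, a, b, b] else []) ++
    parallelCap [] b [a, a, b, b] ++ parallelCap [] a []
end TwistedLinks

/-! ### The basic pair and its state sums -/

namespace TwistedLinks
/-- The double cover in which one of the loops is interchanged. -/
def coverDiagram (left : Bool) : Diagram ℕ :=
  ⟨coverLayers left !left, by cases left <;> decide +kernel⟩

/-- A point of the given component of the double cover. -/
def coverStart (c : ℕ) : ℕ × ℕ := if c = 1 then (1, 0) else (6, 2)

/-- The double cover as an ordered diagram. -/
def coverOrdered (left : Bool) : OrderedDiagram :=
  -- `160` steps reach every point of either component. The point `coverStart 2` lies on the circle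
  -- whether or not the layer of the right interchange is present below it.
  .ofWalk (coverDiagram left) 2 160 coverStart (by cases left <;> decide +kernel)
    (by cases left <;> decide +kernel) (by cases left <;> decide +kernel)

/-- All weights are `1`. Each of the two components has an even number of bars and of passages
through classical crossings, so it carries all four states. -/
theorem stateSum_coverDiagram_count (left : Bool) :
    (coverDiagram left).forget.stateSum (1 : ℤ) 1 = 16 := by
  cases left <;> decide +kernel

/-- Going round the first loop leads back to the same self-crossing after one bar and one change of
parity, so both self-crossings count in every state. The two crossings with the circle count
together, in `4` of the `16` states. The sum is `12t² + 4t⁴`, taken at `t = 2` with inverse `3`. -/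
theorem stateSum_coverDiagram_false :
    (coverDiagram false).forget.stateSum (2 : ZMod 5) 3 = 2 := by
  decide +kernel

/-- Going round the first loop now leads to the other self-crossing. The return to the first one
includes a passage through the circle, which makes the incoming parities equal, so no self-crossing
counts and the sum is `12 + 4t²`. Without the circle the parities would differ here too, and the two
diagrams would have the same sum. -/
theorem stateSum_coverDiagram_true :
    (coverDiagram true).forget.stateSum (2 : ZMod 5) 3 = 3 := by
  decide +kernel
end TwistedLinks

namespace TwistedLinks

/-! ### Checked sequences of virtual moves -/

theorem IsPath.unique {κ : Type} {w : List (Layer κ)} : ∀ {s t t' : List (Strand κ)},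
    IsPath s w t → IsPath s w t' → t = t' := by
  induction w with
  | nil => rintro s t t' rfl h; exact h
  | cons L w ih => exact fun h h' => ih h.2 h'.2

theorem IsPath.widen {κ : Type} (l r : List (Strand κ)) {w : List (Layer κ)} :
    ∀ {s t : List (Strand κ)}, IsPath s w t →
      IsPath (l ++ s ++ r) (w.map (Layer.widen l r)) (l ++ t ++ r) := by
  induction w with
  | nil => rintro s t rfl; rfl
  | cons L w ih =>
    rintro s t ⟨rfl, h⟩
    refine ⟨by simp [Layer.widen, Layer.src], ?_⟩
    have := ih h
    simpa [Layer.widen, Layer.tgt] using this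

theorem IsPath.src_eq {κ : Type} {w : List (Layer κ)} {s t : List (Strand κ)}
    (h : IsPath s w t) {L : Layer κ} (hL : w.head? = some L) : L.src = s := by
  cases w with
  | nil => simp at hL
  | cons L' w => obtain rfl := Option.some.inj hL; exact h.1

/-- Some of the moves between virtual link diagrams. -/
inductive Rule (κ : Type) where
  | exchange (g h : Piece κ) (m : List (Strand κ))
  | crossCap (x : CrossingType) (a b : Strand κ)
  | crossCup (x : CrossingType) (a b : Strand κ)
  | cancel (x : CrossingType) (a b : Strand κ)
  | triangle (x y z : CrossingType) (h : TriangleMove x y z) (a b c : Strand κ)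

/-- One side of a rule. -/
def Rule.lhs {κ : Type} : Rule κ → List (Layer κ)
  | .exchange g h m => [⟨[], g, m ++ h.src⟩, ⟨g.tgt ++ m, h, []⟩]
  | .crossCap x a b => [⟨[], .cross x a b, [a.flip]⟩, ⟨[b], .cap a, []⟩]
  | .crossCup x a b => [⟨[b], .cup a, []⟩, ⟨[], .cross x b a, [a.flip]⟩]
  | .cancel x a b => [⟨[], .cross x a b, []⟩, ⟨[], .cross x.inv b a, []⟩]
  | .triangle x y z _ a b c =>
      [⟨[], .cross x a b, [c]⟩, ⟨[b], .cross y a c, []⟩, ⟨[], .cross z b c, [a]⟩]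

/-- The other side of a rule. -/
def Rule.rhs {κ : Type} : Rule κ → List (Layer κ)
  | .exchange g h m => [⟨g.src ++ m, h, []⟩, ⟨[], g, m ++ h.tgt⟩]
  | .crossCap x a b => [⟨[a], .cross x.inv b a.flip, []⟩, ⟨[], .cap a, [b]⟩]
  | .crossCup x a b => [⟨[], .cup a, [b]⟩, ⟨[a], .cross x.inv a.flip b, []⟩]
  | .cancel _ _ _ => []
  | .triangle x y z _ a b c =>
      [⟨[a], .cross z b c, []⟩, ⟨[], .cross y a c, [b]⟩, ⟨[c], .cross x a b, []⟩]

theorem Rule.move {κ : Type} (ρ : Rule κ) : Isotopy ρ.lhs ρ.rhs ∨ Generalized ρ.lhs ρ.rhs := by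
  cases ρ with
  | exchange g h m => exact .inl (.exchange g h m)
  | crossCap x a b => exact .inl (.cross_cap x a b)
  | crossCup x a b => exact .inl (.cross_cup x a b)
  | cancel x a b => exact .inr (.two x a b)
  | triangle x y z h a b c => exact .inr (.three x y z h a b c)

theorem Rule.isPath {κ : Type} (ρ : Rule κ) :
    ∃ s t, IsPath s ρ.lhs t ∧ IsPath s ρ.rhs t := by
  cases ρ <;> simp [lhs, rhs, IsPath, Layer.src, Layer.tgt, Piece.src, Piece.tgt, Strand.flip]

/-- The sides of a rule, in one of the two directions. -/
def Rule.side {κ : Type} (ρ : Rule κ) : Bool → List (Layer κ)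
  | false => ρ.lhs
  | true => ρ.rhs

instance : ∀ x y z, Decidable (TriangleMove x y z)
  | .over, .under, .over => isFalse id
  | .under, .over, .under => isFalse id
  | .over, .over, .over => isTrue trivial
  | .over, .over, .under => isTrue trivial
  | .over, .under, .under => isTrue trivial
  | .under, .over, .over => isTrue trivial
  | .under, .under, .over => isTrue trivial
  | .under, .under, .under => isTrue trivial
  | .virt, .virt, _ => isTrue trivial
  | .virt, .over, .virt => isTrue trivial
  | .virt, .under, .virt => isTrue trivial
  | .over, .virt, .virt => isTrue trivial
  | .under, .virt, .virt => isTrue trivial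
  | .virt, .over, .over => isFalse id
  | .virt, .over, .under => isFalse id
  | .virt, .under, .over => isFalse id
  | .virt, .under, .under => isFalse id
  | .over, .virt, .over => isFalse id
  | .over, .virt, .under => isFalse id
  | .under, .virt, .over => isFalse id
  | .under, .virt, .under => isFalse id
  | .over, .over, .virt => isFalse id
  | .over, .under, .virt => isFalse id
  | .under, .over, .virt => isFalse id
  | .under, .under, .virt => isFalse id

/-- Read off from the bottom layers how a rule applies to them: the direction, the rule, and the
strands on both sides. The kinds of rules are: exchange, with the left piece below (0) or above
(1); cancellation (2) or creation (3, to the right of `n` strands) of two virtual crossings;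
triangle moves (4 and 5); a crossing moves over a local maximum (6) or through a local minimum
(7). -/
def Rule.read {κ : Type} (kind n : ℕ) (w : List (Layer κ)) :
    Option (Bool × Rule κ × List (Strand κ) × List (Strand κ)) :=
  match kind, w with
  | 0, ⟨l, g, _⟩ :: ⟨l', h, r⟩ :: _ =>
      some (false, .exchange g h (l'.drop (l.length + g.tgt.length)), l, r)
  | 1, ⟨l', h, r⟩ :: ⟨l, g, _⟩ :: _ =>
      some (true, .exchange g h (l'.drop (l.length + g.src.length)), l, r)
  | 2, ⟨l, .cross x a b, r⟩ :: _ => some (false, .cancel x a b, l, r)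
  | 3, L :: _ =>
      match L.src.drop n with
      | a :: b :: r => some (true, .cancel .virt a b, L.src.take n, r)
      | _ => none
  | 4, ⟨l, .cross x a b, _ :: r⟩ :: ⟨_, .cross y _ c, _⟩ :: ⟨_, .cross z _ _, _⟩ :: _ =>
      if h : TriangleMove x y z then some (false, .triangle x y z h a b c, l, r) else none
  | 5, ⟨l, .cross z b c, r⟩ :: ⟨_, .cross y a _, _⟩ :: ⟨_, .cross x _ _, _⟩ :: _ =>
      if h : TriangleMove x y z then some (true, .triangle x y z h a b c, l.dropLast, r) else none
  | 6, ⟨l, .cross x a b, _ :: r⟩ :: _ => some (false, .crossCap x a b, l, r)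
  | 7, ⟨l, .cup a, r⟩ :: ⟨_, .cross x b _, _⟩ :: _ =>
      some (false, .crossCup x a b, l.dropLast, r)
  | _, _ => none

variable {κ : Type} [DecidableEq κ]

/-- Apply a rule to the bottom layers. -/
def rewriteBottom (kind n : ℕ) (w : List (Layer κ)) : Option (List (Layer κ)) :=
  match Rule.read kind n w with
  | none => none
  | some (d, ρ, l, r) =>
      let u := (ρ.side d).map (Layer.widen l r)
      let v := (ρ.side !d).map (Layer.widen l r)
      let q := w.drop u.length
      -- The proposed rule is verified here, so nothing about `Rule.read` has to be proved.
      -- Comparing the bottom strands matters when `u` is empty, as in the creation of two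
      -- crossings.
      if w.take u.length = u ∧ (v ++ q).head?.map Layer.src = w.head?.map Layer.src ∧
        ∀ L ∈ v, L.piece.NotBar then some (v ++ q) else none

/-- Apply a rule to the layers above height `k`. -/
def rewriteAbove (kind n : ℕ) : ℕ → List (Layer κ) → Option (List (Layer κ))
  | k + 1, L :: w => (rewriteAbove kind n k w).map (L :: ·)
  | _, w => rewriteBottom kind n w

/-- Apply a sequence of rules. A rule of kind `i` at height `k` with offset `n` is encoded by the
number `10000 i + 100 k + n`. -/
def rewriteSeq : List ℕ → List (Layer κ) → Option (List (Layer κ))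
  | [], w => some w
  | e :: es, w =>
      match rewriteAbove (e / 10000) (e % 100) (e / 100 % 100) w with
      | none => none
      | some w' => rewriteSeq es w'

theorem rewriteBottom_spec {kind n : ℕ} {w w' : List (Layer κ)}
    (h : rewriteBottom kind n w = some w') : ∃ (d : Bool) (ρ : Rule κ) (l r : List (Strand κ))
      (q : List (Layer κ)), w = (ρ.side d).map (Layer.widen l r) ++ q ∧
        w' = (ρ.side !d).map (Layer.widen l r) ++ q ∧
        (∀ s t, IsPath s w t → IsPath s w' t) ∧
        ((∀ L ∈ w, L.piece.NotBar) → ∀ L ∈ w', L.piece.NotBar) := by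
  unfold rewriteBottom at h
  split at h
  · simp at h
  · rename_i d ρ l r _
    simp only at h
    split_ifs at h with hc
    obtain ⟨hu, hs, hv⟩ := hc
    obtain rfl := Option.some.inj h
    set u := (ρ.side d).map (Layer.widen l r)
    set v := (ρ.side !d).map (Layer.widen l r)
    have hw : w = u ++ w.drop u.length := by
      conv_lhs => rw [← List.take_append_drop u.length w, hu]
    refine ⟨d, ρ, l, r, w.drop u.length, hw, rfl, fun s t hst => ?_, fun hb L hL => ?_⟩
    · obtain ⟨a, b, hl, hr⟩ := ρ.isPath
      have hu' : IsPath (l ++ a ++ r) u (l ++ b ++ r) := by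
        cases d <;> exact IsPath.widen l r (by assumption)
      have hv' : IsPath (l ++ a ++ r) v (l ++ b ++ r) := by
        cases d <;> exact IsPath.widen l r (by assumption)
      have hs' : s = l ++ a ++ r := by
        -- A cancellation has an empty side, but no rule has two; a nonempty side shows what the
        -- bottom strands are.
        have hne : u ≠ [] ∨ v ≠ [] := by
          cases d <;> cases ρ <;> simp [u, v, Rule.side, Rule.lhs, Rule.rhs]
        have hhead : ∀ L, (u ++ w.drop u.length).head? = some L → L.src = s := fun L hL =>
          hst.src_eq (hw ▸ hL)
        rcases hne with hne | hne
        · obtain ⟨L, x, hx⟩ := List.exists_cons_of_ne_nil hne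
          rw [← hhead L (by simp [hx]), hu'.src_eq (by simp [hx])]
        · obtain ⟨L, x, hx⟩ := List.exists_cons_of_ne_nil hne
          rw [hx] at hs
          simp only [List.cons_append, List.head?_cons, Option.map_some] at hs
          obtain ⟨L', hL', hLL'⟩ := Option.map_eq_some_iff.1 hs.symm
          rw [← hst.src_eq hL', hLL', hv'.src_eq (by simp [hx])]
      subst hs'
      rw [hw] at hst
      obtain ⟨m, hm, hq⟩ := hst.split
      obtain rfl := hm.unique hu'
      exact hv'.append hq
    · rcases List.mem_append.1 hL with hL | hL
      · exact hv L hL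
      · exact hb L (List.mem_of_mem_drop hL)

theorem rewriteAbove_spec {kind n : ℕ} : ∀ {k : ℕ} {w w' : List (Layer κ)},
    rewriteAbove kind n k w = some w' → ∃ (d : Bool) (ρ : Rule κ) (l r : List (Strand κ))
      (p q : List (Layer κ)), w = p ++ (ρ.side d).map (Layer.widen l r) ++ q ∧
        w' = p ++ (ρ.side !d).map (Layer.widen l r) ++ q ∧
        (∀ s t, IsPath s w t → IsPath s w' t) ∧
        ((∀ L ∈ w, L.piece.NotBar) → ∀ L ∈ w', L.piece.NotBar) := by
  have base : ∀ {w w' : List (Layer κ)}, rewriteBottom kind n w = some w' →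
      ∃ (d : Bool) (ρ : Rule κ) (l r : List (Strand κ))
      (p q : List (Layer κ)), w = p ++ (ρ.side d).map (Layer.widen l r) ++ q ∧
        w' = p ++ (ρ.side !d).map (Layer.widen l r) ++ q ∧
        (∀ s t, IsPath s w t → IsPath s w' t) ∧
        ((∀ L ∈ w, L.piece.NotBar) → ∀ L ∈ w', L.piece.NotBar) := by
    intro w w' h
    obtain ⟨d, ρ, l, r, q, h⟩ := rewriteBottom_spec h
    exact ⟨d, ρ, l, r, [], q, h⟩
  intro k
  induction k with
  | zero => intro w w' h; exact base (by simpa [rewriteAbove] using h)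
  | succ k ih =>
    intro w w' h
    cases w with
    | nil => exact base (by simpa [rewriteAbove] using h)
    | cons L w =>
      obtain ⟨v, hv, rfl⟩ := Option.map_eq_some_iff.1 h
      obtain ⟨d, ρ, l, r, p, q, hw, hw', hpath, hbar⟩ := ih hv
      refine ⟨d, ρ, l, r, L :: p, q, by simp [hw], by simp [hw'],
        fun s t hst => ⟨hst.1, hpath _ _ hst.2⟩, fun hb M hM => ?_⟩
      rcases List.mem_cons.1 hM with rfl | hM
      · exact hb _ List.mem_cons_self
      · exact hbar (fun N hN => hb N (List.mem_cons_of_mem _ hN)) M hM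

theorem virtualEquiv_of_rewriteSeq : ∀ (es : List ℕ) {D E : VirtualDiagram κ},
    rewriteSeq es D.layers = some E.layers → VirtualEquiv D E := by
  intro es
  induction es with
  | nil =>
    rintro ⟨⟨w, _⟩, _⟩ ⟨⟨w', _⟩, _⟩ h
    obtain rfl := Option.some.inj h
    exact .refl _
  | cons e es ih =>
    intro D E h
    unfold rewriteSeq at h
    split at h
    · simp at h
    · rename_i w hw
      obtain ⟨d, ρ, l, r, p, q, hD, rfl, hpath, hbar⟩ := rewriteAbove_spec hw
      -- The intermediate layers again form a closed path without bars, so the sequence stays among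
      -- virtual diagrams.
      refine .trans _ ⟨⟨_, hpath _ _ D.closed⟩, hbar D.noBar⟩ _ ?_ (ih h)
      cases d
      · exact .rel _ _ (ρ.move.imp (fun h => ⟨p, q, _, _, l, r, h, hD, rfl⟩)
          fun h => ⟨p, q, _, _, l, r, h, hD, rfl⟩)
      · exact .symm _ _ (.rel _ _ (ρ.move.imp (fun h => ⟨p, q, _, _, l, r, h, rfl, hD⟩)
          fun h => ⟨p, q, _, _, l, r, h, rfl, hD⟩))

/-- Moves from the double covering of `coverDiagram false` to that of `coverDiagram true`: the two
copies of each strand are interchanged in the mirror image. -/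
def coverMoves : List ℕ :=
  [10100, 30200, 70100, 10000, 70100, 300, 400, 200, 300, 100, 500, 600, 700, 800, 900, 1000,
    1100, 1200, 40400, 20600, 30804, 50600, 10900, 11000, 21100, 11300, 1100, 1200, 11000, 11100,
    31202, 71100, 11000, 71100, 1500, 1600, 1400, 1500, 1300, 1400, 1200, 1300, 1100, 11900,
    12100, 12000, 12300, 12200, 12100, 1700, 1800, 1900, 2000, 1500, 1600, 1700, 1800, 1900,
    51500, 32004, 41800, 21700, 11600, 31405, 51500, 21700, 41600, 1500, 2100, 2200, 2300, 2400,
    2000, 2100, 2200, 2300, 1900, 2000, 2100, 2200, 1800, 1900, 2000, 2100, 1700, 1600, 1500,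
    1800, 1700, 1900, 12700, 12900, 12800, 13100, 13000, 12900, 2500, 2600, 2700, 2800, 2400,
    2500, 2600, 2700, 12200, 52300, 32804, 42600, 22500, 12400, 32205, 52300, 22500, 42400, 2300,
    2900, 3000, 3100, 3200, 2800, 2900, 3000, 3100, 2700, 2800, 2900, 3000, 2600, 2700, 2800,
    2900, 2500, 2400, 2300, 2600, 2500, 2700, 3300, 3200, 13000, 13100, 3400, 3300, 3200, 3100,
    13700, 3200, 13400, 13300, 13400, 3400, 63500, 3600, 63500, 23400, 3300, 3400, 13200, 13300,
    3500, 3600, 3400, 3500, 3300, 13900, 3700, 3800, 3600, 3700, 33804, 73700, 13600, 73700, 4100,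
    4200, 4000, 4100, 3900, 4000, 3800, 3900, 3700, 14500, 14700, 14600, 14900, 14800, 14700,
    4300, 4400, 4500, 4600, 14000, 14100, 14200, 14300, 14400, 14500, 14000, 54100, 34602, 44400,
    24300, 14200, 34003, 54100, 24300, 44200, 4100, 4700, 4800, 4900, 5000, 4600, 4700, 4800,
    4900, 4500, 4600, 4700, 4800, 4400, 4500, 4600, 4700, 4300, 4200, 4100, 4400, 4300, 4500,
    5100, 5200, 5300, 5400, 5500, 5600, 4900, 5000, 5100, 5200, 5300, 5400, 5500, 4800, 4900,
    5000, 5100, 5200, 5300, 5400, 44800, 25000, 35208, 55000, 15300, 35406, 5500, 16100, 15700,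
    15600, 15800, 15700, 15800, 5800, 65900, 6000, 65900, 25800, 5700, 5800, 5600, 5700, 5900,
    6000, 5800, 5900, 5700, 16300, 16000, 6000, 66100, 6200, 66100, 26000, 6100]

/-- Once the copies are interchanged over the mirror image, passing a bar interchanges them too. The
loop that had an interchange loses it, the other loop gains one, and the circle, which has no bar,
keeps its own. -/
theorem virtualEquiv_double_coverDiagram :
    VirtualEquiv (coverDiagram false).double (coverDiagram true).double :=
  virtualEquiv_of_rewriteSeq coverMoves (by decide +kernel)

end TwistedLinks

namespace TwistedLinks

/-! ### Adding a circle -/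

section Append
variable {κ : Type}

/-- The diagram `D` with further closed layers on top. -/
def Diagram.append (D : Diagram κ) (w : List (Layer κ)) (hw : IsPath [] w []) : Diagram κ :=
  ⟨D.layers ++ w, D.closed.append hw⟩

theorem getElem?_append_of_eq_some {α : Type*} {l : List α} {k : ℕ} {a : α}
    (h : l[k]? = some a) (l' : List α) : (l ++ l')[k]? = some a := by
  obtain ⟨hk, -⟩ := List.getElem?_eq_some_iff.1 h
  rw [List.getElem?_append_left hk, h]

theorem Diagram.Joined.append {D : Diagram κ} {w : List (Layer κ)} (hw : IsPath [] w [])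
    {p q : ℕ × ℕ} (h : D.Joined p q) : (D.append w hw).Joined p q := by
  cases h with
  | left k i L hL hi => exact .left k i L (getElem?_append_of_eq_some hL w) hi
  | right k i L hL hi => exact .right k i L (getElem?_append_of_eq_some hL w) hi
  | cup k l r a hL => exact .cup k l r a (getElem?_append_of_eq_some hL w)
  | cap k l r a hL => exact .cap k l r a (getElem?_append_of_eq_some hL w)
  | cross_left k l r x a b hL => exact .cross_left k l r x a b (getElem?_append_of_eq_some hL w)
  | cross_right k l r x a b hL => exact .cross_right k l r x a b (getElem?_append_of_eq_some hL w)
  | bar k l r a hL => exact .bar k l r a (getElem?_append_of_eq_some hL w)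

/-- The virtual diagram `D` with further closed layers on top. -/
def VirtualDiagram.append (D : VirtualDiagram κ) (w : List (Layer κ)) (hw : IsPath [] w [])
    (hb : ∀ L ∈ w, L.piece.NotBar) : VirtualDiagram κ where
  toDiagram := D.toDiagram.append w hw
  noBar L hL := (List.mem_append.1 hL).elim (D.noBar L) (hb L)

theorem Replace.append {R : List (Layer κ) → List (Layer κ) → Prop} {D E : Diagram κ}
    (h : Replace R D E) (w : List (Layer κ)) (hw : IsPath [] w []) :
    Replace R (D.append w hw) (E.append w hw) := by
  obtain ⟨p, q, u, v, l, r, hR, hD, hE⟩ := h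
  exact ⟨p, q ++ w, u, v, l, r, hR, by simp [Diagram.append, hD], by simp [Diagram.append, hE]⟩

theorem VirtualEquiv.append {D E : VirtualDiagram κ} (h : VirtualEquiv D E) (w : List (Layer κ))
    (hw : IsPath [] w []) (hb : ∀ L ∈ w, L.piece.NotBar) :
    VirtualEquiv (D.append w hw hb) (E.append w hw hb) :=
  eqvGen_map (fun D : VirtualDiagram κ => D.append w hw hb)
    (fun _ _ h => h.imp (fun h => h.append w hw) fun h => h.append w hw) h

/-- A circle of the given colour. -/
def circleLayers (c : κ) : List (Layer κ) := [⟨[], .cup ⟨c, true⟩, []⟩, ⟨[], .cap ⟨c, true⟩, []⟩]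

theorem isPath_circleLayers (c : κ) : IsPath [] (circleLayers c) [] := ⟨rfl, rfl, rfl⟩

/-- Level `k + 1` is read off from the layer with index `k`, so the heights up to `D.layers.length`
still belong to `D`. -/
theorem Diagram.level_append_circle_of_le (D : Diagram κ) (c : κ) {k : ℕ}
    (hk : k ≤ D.layers.length) :
    (D.append _ (isPath_circleLayers c)).level k = D.level k := by
  cases k with
  | zero => rfl
  | succ k => simp only [level, append]; rw [List.getElem?_append_left hk]

theorem Diagram.level_append_circle (D : Diagram κ) (c : κ) :
    (D.append _ (isPath_circleLayers c)).level (D.layers.length + 1) =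
      [⟨c, true⟩, ⟨c, false⟩] := by
  simp [level, append, circleLayers, Layer.tgt, Piece.tgt, Strand.flip]

theorem Diagram.level_append_circle_of_lt (D : Diagram κ) (c : κ) {k : ℕ}
    (hk : D.layers.length + 1 < k) :
    (D.append _ (isPath_circleLayers c)).level k = [] := by
  obtain ⟨k, rfl⟩ : ∃ k', k = D.layers.length + (k' + 1) + 1 :=
    ⟨k - D.layers.length - 2, by omega⟩
  simp only [level, append]
  rw [List.getElem?_append_right (by omega)]
  cases k <;> simp [circleLayers, Layer.tgt, Piece.tgt]

theorem Diagram.level_append_circle_cases (D : Diagram κ) (c : κ) {k i : ℕ} {a : Strand κ}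
    (h : ((D.append _ (isPath_circleLayers c)).level k)[i]? = some a) :
    (D.level k)[i]? = some a ∨ a.color = c ∧ k = D.layers.length + 1 ∧ (i = 0 ∨ i = 1) := by
  rcases lt_trichotomy k (D.layers.length + 1) with hk | rfl | hk
  · exact .inl (by rwa [D.level_append_circle_of_le c (by omega)] at h)
  · rw [D.level_append_circle] at h
    rcases i with _ | _ | i <;> simp at h <;> simp [← h]
  · simp [D.level_append_circle_of_lt c hk] at h

end Append

theorem Diagram.mem_level_append_circle {κ : Type} (D : Diagram κ) (c : κ) {k : ℕ}
    {a : Strand κ} (h : a ∈ D.level k) : a ∈ (D.append _ (isPath_circleLayers c)).level k := by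
  by_cases hk : k ≤ D.layers.length
  · rwa [D.level_append_circle_of_le c hk]
  · rw [D.level_eq_nil (by omega)] at h
    simp at h

/-- An ordered diagram with a further component, a circle apart from the diagram. -/
def OrderedDiagram.addCircle (D : OrderedDiagram) : OrderedDiagram where
  toDiagram := D.toDiagram.append _ (isPath_circleLayers (D.numComponents + 1))
  numComponents := D.numComponents + 1
  numbers := by
    intro c
    constructor
    · rintro ⟨k, a, ha, rfl⟩
      obtain ⟨i, hi⟩ := List.getElem?_of_mem ha
      rcases D.level_append_circle_cases _ hi with h | ⟨h, -⟩
      · have := (D.numbers a.color).1 ⟨k, a, List.mem_of_getElem? h, rfl⟩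
        omega
      · omega
    · rintro ⟨h₁, h₂⟩
      rcases Nat.lt_or_eq_of_le h₂ with h | rfl
      · obtain ⟨k, a, ha, hc⟩ := (D.numbers c).2 ⟨h₁, by omega⟩
        exact ⟨k, a, D.mem_level_append_circle _ ha, hc⟩
      · exact ⟨D.layers.length + 1, ⟨_, true⟩, by
          rw [D.level_append_circle]; exact List.mem_cons_self, rfl⟩
  one_component := by
    have old : ∀ {k i : ℕ} {a : Strand ℕ}, (D.level k)[i]? = some a →
        a.color ≠ D.numComponents + 1 := fun {k i a} h e => by
      have := (D.numbers a.color).1 ⟨k, a, List.mem_of_getElem? h, rfl⟩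
      omega
    have hj : (D.toDiagram.append _ (isPath_circleLayers (D.numComponents + 1))).Joined
        (D.layers.length + 1, 0) (D.layers.length + 1, 1) :=
      .cup D.layers.length [] [] ⟨D.numComponents + 1, true⟩
        (by simp [Diagram.append, circleLayers])
    intro k k' i i' a a' ha ha' hc
    rcases D.level_append_circle_cases _ ha with h | ⟨h, rfl, hi⟩ <;>
      rcases D.level_append_circle_cases _ ha' with h' | ⟨h', rfl, hi'⟩
    · exact eqvGen_map id (fun _ _ => Diagram.Joined.append _) (D.one_component _ _ _ _ _ _ h h' hc)
    · exact (old h (hc.trans h')).elim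
    · exact (old h' (hc.symm.trans h)).elim
    · rcases hi with rfl | rfl <;> rcases hi' with rfl | rfl
      · exact .refl _
      · exact .rel _ _ hj
      · exact .symm _ _ (.rel _ _ hj)
      · exact .refl _

/-- Doubling works layer by layer, so the covering of the added circle lies on top of the old
covering and the moves below are not disturbed. Equal numbers of components give the new circles the
same label. -/
theorem OrderedDiagram.virtualEquiv_double_addCircle {D E : OrderedDiagram}
    (hn : D.numComponents = E.numComponents)
    (h : VirtualEquiv D.toDiagram.double E.toDiagram.double) :
    VirtualEquiv D.addCircle.toDiagram.double E.addCircle.toDiagram.double := by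
  have key : ∀ D : OrderedDiagram, D.addCircle.toDiagram.double = D.toDiagram.double.append
      ((circleLayers (D.numComponents + 1)).flatMap Layer.double)
      (isPath_flatMap_double (isPath_circleLayers _)) (fun L hL => by
        obtain ⟨L', _, h⟩ := List.mem_flatMap.1 hL
        exact notBar_double L' L h) := fun D => by
    simp only [addCircle, Diagram.double, VirtualDiagram.append, Diagram.append,
      List.flatMap_append]
  rw [key, key]
  simp only [hn]
  exact h.append _ _ _

section StateSum
variable {R : Type} [CommRing R]

theorem pieceSum_smul (t s r : R) (p : Piece Unit) (F : List State → R) (c : List State) :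
    pieceSum t s p (fun d => r * F d) c = r * pieceSum t s p F c := by
  cases p with
  | cup a => simp only [pieceSum, mul_sumStates]
  | _ =>
    rcases c with _ | ⟨x, _ | ⟨y, c⟩⟩ <;> simp only [pieceSum, mul_zero, mul_ite]
    all_goals try ring

theorem stateSum_smul (t s r : R) (w : List (Layer Unit)) (F : List State → R) :
    stateSum t s w (fun d => r * F d) = fun c => r * stateSum t s w F c := by
  induction w with
  | nil => rfl
  | cons L w ih =>
    funext c
    simp only [stateSum, layerSum, ih, pieceSum_smul]

/-- The circle has four states, each of weight `1`; linearity moves this constant out of the sum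
below. -/
theorem OrderedDiagram.stateSum_addCircle (t s : R) (D : OrderedDiagram) :
    D.addCircle.forget.stateSum t s = 4 * D.forget.stateSum t s := by
  have e : stateSum t s ((circleLayers (D.numComponents + 1)).map Layer.forget)
      (fun _ => 1) = fun _ => 4 * 1 := by
    funext c
    simp [circleLayers, Layer.forget, Piece.forget, stateSum, layerSum, pieceSum, sumStates]
    norm_num
  simp only [Diagram.stateSum, Diagram.forget, addCircle, Diagram.append, List.map_append,
    stateSum_append, e, stateSum_smul]

end StateSum

/-! ### The infinite family -/

/-- The double cover together with `n` circles. -/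
def coverWithCircles (left : Bool) : ℕ → OrderedDiagram
  | 0 => coverOrdered left
  | n + 1 => (coverWithCircles left n).addCircle

theorem numComponents_coverWithCircles (left : Bool) (n : ℕ) :
    (coverWithCircles left n).numComponents = n + 2 := by
  induction n with
  | zero => rfl
  | succ n ih => simp only [coverWithCircles, OrderedDiagram.addCircle, ih]

theorem virtualEquiv_double_coverWithCircles (n : ℕ) :
    VirtualEquiv (coverWithCircles false n).toDiagram.double
      (coverWithCircles true n).toDiagram.double := by
  induction n with
  | zero => exact virtualEquiv_double_coverDiagram
  | succ n ih =>
    exact OrderedDiagram.virtualEquiv_double_addCircle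
      (by simp only [numComponents_coverWithCircles]) ih

theorem stateSum_coverWithCircles {R : Type} [CommRing R] (t s : R) (left : Bool) (n : ℕ) :
    (coverWithCircles left n).forget.stateSum t s =
      4 ^ n * (coverDiagram left).forget.stateSum t s := by
  induction n with
  | zero => simp [coverWithCircles, coverOrdered, OrderedDiagram.ofWalk]
  | succ n ih => rw [coverWithCircles, OrderedDiagram.stateSum_addCircle, ih]; ring

theorem not_unorderedEquiv_coverWithCircles (n : ℕ) :
    ¬ UnorderedEquiv (coverWithCircles false n).forget (coverWithCircles true n).forget := by
  intro h
  -- In `ZMod 5` the product `2 * 3` is `1`.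
  have e := h.stateSum_eq (t := (2 : ZMod 5)) (s := 3) rfl
  rw [stateSum_coverWithCircles, stateSum_coverWithCircles, stateSum_coverDiagram_false,
    stateSum_coverDiagram_true] at e
  have h4 : IsUnit ((4 : ZMod 5) ^ n) := (IsUnit.of_mul_eq_one 4 (by decide)).pow n
  exact absurd (h4.mul_left_cancel e) (by decide)

theorem eq_of_unorderedEquiv_coverWithCircles {l l' : Bool} {n n' : ℕ}
    (h : UnorderedEquiv (coverWithCircles l n).forget (coverWithCircles l' n').forget) :
    n = n' := by
  -- At `t = s = 1` the sum only counts states, which gives `16 * 4 ^ n` for both members of the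
  -- pair.
  have e := h.stateSum_eq (t := (1 : ℤ)) (s := 1) rfl
  rw [stateSum_coverWithCircles, stateSum_coverWithCircles, stateSum_coverDiagram_count,
    stateSum_coverDiagram_count] at e
  have e' : (4 : ℤ) ^ n = 4 ^ n' := by linarith
  exact Nat.pow_right_injective (by norm_num : 2 ≤ 4) (by exact_mod_cast e')

theorem OrderedDiagram.link_eq_iff {D E : OrderedDiagram} :
    D.link = E.link ↔ OrderedEquiv D E :=
  Quotient.eq (r := Relation.EqvGen.setoid
    (fun D E : OrderedDiagram => TwistedMove D.toDiagram E.toDiagram))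

theorem Diagram.unorderedLink_eq_iff {D E : Diagram Unit} :
    D.unorderedLink = E.unorderedLink ↔ UnorderedEquiv D E :=
  Quotient.eq (r := Relation.EqvGen.setoid (TwistedMove (κ := Unit)))

end TwistedLinks

theorem theorem5p2 :
    (∃ Dx Dy : ℕ+ → TwistedLinks.OrderedDiagram,
      (∀ n : ℕ+,
        ¬ TwistedLinks.OrderedEquiv (Dx n) (Dy n) ∧
        ¬ TwistedLinks.UnorderedEquiv (Dx n).forget (Dy n).forget ∧
        TwistedLinks.VirtualEquiv (Dx n).double (Dy n).double ∧
        TwistedLinks.VirtualEquiv (Dx n).double.forget (Dy n).double.forget) ∧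
      (∀ n n' : ℕ+, n ≠ n' →
        ∀ D ∈ ({Dx n, Dy n} : Set TwistedLinks.OrderedDiagram),
        ∀ E ∈ ({Dx n', Dy n'} : Set TwistedLinks.OrderedDiagram),
          ¬ TwistedLinks.OrderedEquiv D E ∧
          ¬ TwistedLinks.UnorderedEquiv D.forget E.forget)) ∧
    {p : TwistedLinks.OrderedTwistedLink × TwistedLinks.OrderedTwistedLink | p.1 ≠ p.2 ∧
      ∃ D E : TwistedLinks.OrderedDiagram, D.link = p.1 ∧ E.link = p.2 ∧
        TwistedLinks.VirtualEquiv D.double E.double}.Infinite ∧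
    {p : TwistedLinks.UnorderedTwistedLink × TwistedLinks.UnorderedTwistedLink | p.1 ≠ p.2 ∧
      ∃ D E : TwistedLinks.Diagram Unit, D.unorderedLink = p.1 ∧ E.unorderedLink = p.2 ∧
        TwistedLinks.VirtualEquiv D.double E.double}.Infinite := by
  open TwistedLinks in
  refine ⟨⟨fun n => coverWithCircles false n, fun n => coverWithCircles true n, fun n => ?_,
    fun n n' hn D hD E hE => ?_⟩, ?_, ?_⟩
  · exact ⟨fun h => not_unorderedEquiv_coverWithCircles n h.forget,
      not_unorderedEquiv_coverWithCircles n, virtualEquiv_double_coverWithCircles n,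
      (virtualEquiv_double_coverWithCircles n).forget⟩
  · obtain ⟨l, rfl⟩ : ∃ l, D = coverWithCircles l n := by
      rcases hD with rfl | rfl
      exacts [⟨_, rfl⟩, ⟨_, rfl⟩]
    obtain ⟨l', rfl⟩ : ∃ l', E = coverWithCircles l' n' := by
      rcases hE with rfl | rfl
      exacts [⟨_, rfl⟩, ⟨_, rfl⟩]
    have key : ¬ UnorderedEquiv (coverWithCircles l n).forget (coverWithCircles l' n').forget :=
      fun h => hn (PNat.coe_injective (eq_of_unorderedEquiv_coverWithCircles h))
    exact ⟨fun h => key h.forget, key⟩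
  · refine Set.infinite_of_injective_forall_mem (f := fun n : ℕ =>
      ((coverWithCircles false n).link, (coverWithCircles true n).link)) (fun n n' h => ?_)
      fun n => ⟨fun h => ?_, _, _, rfl, rfl, virtualEquiv_double_coverWithCircles n⟩
    · exact eq_of_unorderedEquiv_coverWithCircles
        (OrderedDiagram.link_eq_iff.1 (Prod.mk.inj h).1).forget
    · exact not_unorderedEquiv_coverWithCircles n (OrderedDiagram.link_eq_iff.1 h).forget
  · refine Set.infinite_of_injective_forall_mem (f := fun n : ℕ =>
      ((coverWithCircles false n).forget.unorderedLink,
        (coverWithCircles true n).forget.unorderedLink)) (fun n n' h => ?_)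
      fun n => ⟨fun h => ?_, _, _, rfl, rfl, ?_⟩
    · exact eq_of_unorderedEquiv_coverWithCircles
        (Diagram.unorderedLink_eq_iff.1 (Prod.mk.inj h).1)
    · exact not_unorderedEquiv_coverWithCircles n (Diagram.unorderedLink_eq_iff.1 h)
    · rw [Diagram.double_forget, Diagram.double_forget]
      exact (virtualEquiv_double_coverWithCircles n).forget
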